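/- Let $\mathfrak{f}(\tau) = \zeta_{48}^{-1}\,\eta\!\left(\frac{\tau+1}{2}\right)/\eta(\tau)$, where $\zeta_{48} = e^{2\pi i/48}$ and $\eta$ is the Dedekind eta function, be the Weber function on the upper half-plane $\mathbb{H}$. Let $\ell$ be a prime number not dividing $48$ (that is, $\ell \ge 5$). Then there exists an irreducible polynomial $\Phi_\ell(x,y) \in \mathbb{Z}[x,y]$ with $$\Phi_\ell(\mathfrak{f}(\tau), \mathfrak{f}(\ell\tau)) = 0 \quad \text{for all } \tau \in \mathbb{H}$$ (the Weber modular polynomial of level $\ell$, which is determined up to sign), and every such polynomial satisfies $$\Phi_\ell(\zeta_{24}\, x, \zeta_{24}^{\ell}\, y) = \zeta_{24}^{\ell+1}\, \Phi_\ell(x,y)$$ in $\mathbb{C}[x,y]$ for every primitive $24$-th root of unity $\zeta_{24} \in \mathbb{C}$. -/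

import Mathlib

noncomputable section

namespace WeberModular

/-- The Weber function `𝔣(τ) = ζ₄₈⁻¹ η((τ + 1) / 2) / η(τ)` with `ζ₄₈ = exp(2πi/48)`, where `η` is
the Dedekind eta function. It is only used for `τ` in the upper half-plane. -/
def weberF (τ : ℂ) : ℂ :=
  (Complex.exp (2 * Real.pi * Complex.I / 48))⁻¹ *
    (ModularForm.eta ((τ + 1) / 2) / ModularForm.eta τ)

/-- `Φ ∈ ℤ[x, y]` (with `x = X 0`, `y = X 1`) is a Weber modular polynomial of level `ℓ`: it is
irreducible in `ℤ[x, y]` and `Φ(𝔣(τ), 𝔣(ℓτ)) = 0` for all `τ` in the upper half-plane.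
Such a `Φ` is determined up to sign. -/
def IsWeberModularPolynomial (ℓ : ℕ) (Φ : MvPolynomial (Fin 2) ℤ) : Prop :=
  Irreducible Φ ∧
    ∀ τ : UpperHalfPlane,
      MvPolynomial.aeval ![weberF (τ : ℂ), weberF ((ℓ : ℂ) * (τ : ℂ))] Φ = 0

end WeberModular

end

/-!
The Weber function is invariant under `τ ↦ -1/τ`, and `Γ(2)` acts on it through a character of
order `24`. Hence the functions `𝔣(ℓτ)` and `𝔣((τ + 48 k) / ℓ)`, for `k` modulo `ℓ`, are permuted,
up to roots of unity, by the theta group, which `τ ↦ τ + 2` and `τ ↦ -1/τ` generate. Their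
elementary symmetric functions are polynomials in `𝔣(τ)`: subtracting a polynomial in `𝔣(τ)` removes
the pole at `∞`, and what is left vanishes because its norm to level one does. This yields a
relation `F(𝔣(τ), 𝔣(ℓτ)) = 0` which is monic of degree `ℓ + 1` in `y`. No relation has smaller
degree, because the `ℓ + 1` conjugates are distinct. As the `q`-expansion of `𝔣` is integral,
applying a `ℚ`-linear projection `ℂ → ℚ` to the coefficients of `F` gives another relation, so `F`
is rational, and by Gauss's lemma an irreducible integral relation is a constant multiple of `F`.

Substituting `τ - 2` for `τ` shows that `F(ζ₂₄ x, ζ₂₄ ^ ℓ y)` is a relation as well, hence equal to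
`F` up to its leading coefficient, which is `ζ₂₄ ^ (ℓ (ℓ + 1)) = ζ₂₄ ^ (ℓ + 1)` since
`ℓ ^ 2 ≡ 1` modulo `24`.
-/

open Complex Filter Asymptotics Function.Periodic
open UpperHalfPlane (upperHalfPlaneSet isOpen_upperHalfPlaneSet)
open scoped Real Topology

noncomputable section

namespace WeberModular

/-! ### The generators of the theta group -/

/-- The primitive `24`-th root of unity `exp(2πi/24)`. -/
def zeta24 : ℂ := cexp (2 * π * I / 24)

lemma zeta24_isPrimitiveRoot : IsPrimitiveRoot zeta24 24 := by
  simpa [zeta24] using Complex.isPrimitiveRoot_exp 24 (by norm_num)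

lemma zeta24_pow : zeta24 ^ 24 = 1 := zeta24_isPrimitiveRoot.pow_eq_one

lemma zeta24_ne_zero : zeta24 ≠ 0 := Complex.exp_ne_zero _

lemma norm_zeta24 : ‖zeta24‖ = 1 := norm_eq_one_of_pow_eq_one zeta24_pow (by norm_num)

lemma zeta24_zpow_eq_of_modEq {m n : ℤ} (h : m ≡ n [ZMOD 24]) : zeta24 ^ m = zeta24 ^ n := by
  obtain ⟨k, hk⟩ := h.symm.dvd
  have h24 : zeta24 ^ (24 : ℤ) = 1 := by exact_mod_cast zeta24_pow
  rw [eq_add_of_sub_eq' hk, zpow_add₀ zeta24_ne_zero, zpow_mul, h24, one_zpow, mul_one]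

lemma qParam_add (h : ℝ) (z w : ℂ) : qParam h (z + w) = qParam h z * qParam h w := by
  simp only [qParam, ← Complex.exp_add]
  ring_nf

lemma eta_add_one (z : ℂ) : ModularForm.eta (z + 1) = zeta24 * ModularForm.eta z := by
  have h1 : qParam 1 (z + 1) = qParam 1 z := by
    rw [qParam_add]
    simp [qParam]
  have h24 : qParam 24 (z + 1) = zeta24 * qParam 24 z := by
    rw [qParam_add, mul_comm]
    simp [qParam, zeta24]
  simp only [ModularForm.eta, ModularForm.eta_q, h1, h24, mul_assoc]

lemma weberF_add_two (z : ℂ) : weberF (z + 2) = zeta24⁻¹ * weberF z := by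
  have h1 : (z + 2 + 1) / 2 = (z + 1) / 2 + 1 := by ring
  have h2 : z + 2 = z + 1 + 1 := by ring
  rw [weberF, weberF, h1, eta_add_one, h2, eta_add_one, eta_add_one]
  have := zeta24_ne_zero
  field_simp

lemma weberF_add_two_mul_int (n : ℤ) (z : ℂ) : weberF (z + 2 * n) = zeta24 ^ (-n) * weberF z := by
  induction n with
  | zero => simp
  | succ n ih =>
    rw [show z + 2 * ((n + 1 : ℤ) : ℂ) = z + 2 * (n : ℤ) + 2 by push_cast; ring, weberF_add_two, ih,
      neg_add, zpow_add₀ zeta24_ne_zero, zpow_neg_one]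
    ring
  | pred n ih =>
    have h := weberF_add_two (z + 2 * ((-n - 1 : ℤ) : ℂ))
    rw [show z + 2 * ((-n - 1 : ℤ) : ℂ) + 2 = z + 2 * ((-n : ℤ) : ℂ) by push_cast; ring, ih,
      eq_inv_mul_iff_mul_eq₀ zeta24_ne_zero] at h
    rw [← h, show -(-(n : ℤ) - 1) = 1 + -(-n) by ring, zpow_one_add₀ zeta24_ne_zero, mul_assoc]

lemma weberF_add_int_of_dvd {m : ℤ} (hm : (48 : ℤ) ∣ m) (z : ℂ) : weberF (z + m) = weberF z := by
  obtain ⟨k, rfl⟩ := hm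
  have h := weberF_add_two_mul_int (24 * k) z
  rw [zeta24_zpow_eq_of_modEq (n := 0) (Int.modEq_zero_iff_dvd.mpr ⟨-k, by ring⟩), zpow_zero,
    one_mul] at h
  rw [← h]
  push_cast
  ring_nf

lemma im_neg_one_div_pos {z : ℂ} (hz : 0 < z.im) : 0 < (-1 / z).im := by
  simpa [neg_div] using UpperHalfPlane.im_inv_neg_coe_pos ⟨z, hz⟩

lemma ne_zero_of_im_pos {z : ℂ} (hz : 0 < z.im) : z ≠ 0 := UpperHalfPlane.ne_zero ⟨z, hz⟩

lemma im_half_add_one_pos {z : ℂ} (hz : 0 < z.im) : 0 < ((z + 1) / 2).im := by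
  simpa using hz

lemma im_nat_mul_pos {n : ℕ} (hn : 0 < n) {z : ℂ} (hz : 0 < z.im) : 0 < ((n : ℂ) * z).im := by
  simp [hz, hn]

lemma weberF_ne_zero {z : ℂ} (hz : 0 < z.im) : weberF z ≠ 0 :=
  mul_ne_zero (inv_ne_zero (Complex.exp_ne_zero _))
    (div_ne_zero (ModularForm.eta_ne_zero (im_half_add_one_pos hz)) (ModularForm.eta_ne_zero hz))

lemma differentiableAt_weberF {z : ℂ} (hz : 0 < z.im) : DifferentiableAt ℂ weberF z := by
  have hnum : DifferentiableAt ℂ (fun w : ℂ => ModularForm.eta ((w + 1) / 2)) z :=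
    (ModularForm.differentiableAt_eta_of_mem_upperHalfPlaneSet (im_half_add_one_pos hz)).comp z
      (f := fun w : ℂ => (w + 1) / 2) (by fun_prop)
  exact (hnum.div (ModularForm.differentiableAt_eta_of_mem_upperHalfPlaneSet hz)
    (ModularForm.eta_ne_zero hz)).const_mul _

lemma sqrt_pow_twentyFour (z : ℂ) : Complex.sqrt z ^ 24 = z ^ 12 := by
  rw [Complex.sqrt, ← Complex.cpow_nat_mul, ← Complex.cpow_natCast]
  norm_num

lemma eta_neg_inv_pow {z : ℂ} (hz : 0 < z.im) :
    ModularForm.eta (-1 / z) ^ 24 = z ^ 12 * ModularForm.eta z ^ 24 := by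
  have h : ModularForm.eta (-1 / z) = (Complex.sqrt I)⁻¹ * (Complex.sqrt z * ModularForm.eta z) :=
    ModularForm.eta_comp_eq_csqrt_I_inv hz
  have hI : I ^ 12 = 1 := by
    rw [show 12 = 4 * 3 by norm_num, pow_mul, I_pow_four, one_pow]
  rw [h, mul_pow, mul_pow, inv_pow, sqrt_pow_twentyFour, sqrt_pow_twentyFour, hI, inv_one, one_mul]

lemma eta_add_one_pow (z : ℂ) : ModularForm.eta (z + 1) ^ 24 = ModularForm.eta z ^ 24 := by
  rw [eta_add_one, mul_pow, zeta24_pow, one_mul]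

lemma weberF_pow (z : ℂ) :
    weberF z ^ 24 = -(ModularForm.eta ((z + 1) / 2) ^ 24 / ModularForm.eta z ^ 24) := by
  have h : cexp (2 * π * I / 48) ^ 24 = -1 := by
    rw [← Complex.exp_nat_mul, ← Complex.exp_pi_mul_I]
    congr 1
    push_cast
    ring
  rw [weberF, mul_pow, inv_pow, h, div_pow]
  ring

lemma weberF_neg_inv_pow {z : ℂ} (hz : 0 < z.im) : weberF (-1 / z) ^ 24 = weberF z ^ 24 := by
  obtain ⟨s, rfl⟩ : ∃ s, z = 2 * s + 1 := ⟨(z - 1) / 2, by ring⟩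
  have hs : 0 < s.im := by simpa using hz
  have hs0 := ne_zero_of_im_pos hs
  have hz0 := ne_zero_of_im_pos hz
  have hw : 0 < (-1 / s - 2).im := by simpa using im_neg_one_div_pos hs
  have hws : -1 / s - 2 = -(2 * s + 1) / s := by field_simp; ring
  have eta_sub_two_pow (w : ℂ) : ModularForm.eta (w - 2) ^ 24 = ModularForm.eta w ^ 24 := by
    rw [← eta_add_one_pow, ← eta_add_one_pow]
    ring_nf
  -- `(S z + 1) / 2 = S T⁻² S s`
  have hnum : ModularForm.eta ((-1 / (2 * s + 1) + 1) / 2) ^ 24 =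
      (2 * s + 1) ^ 12 * ModularForm.eta ((2 * s + 1 + 1) / 2) ^ 24 := by
    have hleft : (-1 / (2 * s + 1) + 1) / 2 = -1 / (-1 / s - 2) := by
      rw [hws]
      field_simp
      ring
    have hright : (2 * s + 1 + 1) / 2 = s + 1 := by ring
    rw [hleft, hright, eta_neg_inv_pow hw, eta_sub_two_pow, eta_neg_inv_pow hs, eta_add_one_pow,
      hws]
    field_simp
  rw [weberF_pow, weberF_pow, hnum, eta_neg_inv_pow hz]
  have := ModularForm.eta_ne_zero hz
  field_simp

lemma eq_of_pow_eq_one_of_isPreconnected {X K : Type*} [TopologicalSpace X] {S : Set X}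
    (hS : IsPreconnected S) [CommRing K] [IsDomain K] [TopologicalSpace K] [T1Space K] {u : X → K}
    (hu : ContinuousOn u S) {n : ℕ} (hn : 0 < n) (hpow : ∀ x ∈ S, u x ^ n = 1) {x y : X}
    (hx : x ∈ S) (hy : y ∈ S) : u x = u y := by
  have hdisc : IsDiscrete (Polynomial.nthRootsFinset n (1 : K) : Set K) :=
    (Finset.finite_toSet _).isDiscrete
  exact hS.constant_of_mapsTo hdisc hu
    (fun x hx => (Polynomial.mem_nthRootsFinset hn 1).mpr (hpow x hx)) hx hy

lemma weberF_neg_inv {z : ℂ} (hz : 0 < z.im) : weberF (-1 / z) = weberF z := by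
  have hI : 0 < I.im := by simp
  have hdiff : DifferentiableOn ℂ (fun w => weberF (-1 / w) / weberF w) upperHalfPlaneSet := by
    intro w hw
    have hS : DifferentiableAt ℂ (fun w : ℂ => weberF (-1 / w)) w :=
      (differentiableAt_weberF (im_neg_one_div_pos hw)).comp w (f := fun w : ℂ => -1 / w)
        (DifferentiableAt.div (by fun_prop) (by fun_prop) (ne_zero_of_im_pos hw))
    exact (hS.div (differentiableAt_weberF hw) (weberF_ne_zero hw)).differentiableWithinAt
  have hpow (w : ℂ) (hw : w ∈ upperHalfPlaneSet) : (weberF (-1 / w) / weberF w) ^ 24 = 1 := by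
    rw [div_pow, weberF_neg_inv_pow hw, div_self (pow_ne_zero _ (weberF_ne_zero hw))]
  -- the quotient is locally constant, and it is `1` at the fixed point `I`
  have hconst := eq_of_pow_eq_one_of_isPreconnected (convex_halfSpace_im_gt 0).isPreconnected
    hdiff.continuousOn (by norm_num) hpow hz hI
  have hfix : -1 / I = I := by rw [div_eq_iff I_ne_zero, I_mul_I]
  simp only [hfix, div_self (weberF_ne_zero hI)] at hconst
  exact (div_eq_one_iff_eq (weberF_ne_zero hz)).mp hconst

/-! ### Behaviour at the cusps -/

/-- The Euler product `∏ (1 - xⁿ)`, through which `η` and `𝔣` are expanded in `q`. -/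
def eulerProd (x : ℂ) : ℂ := ∏' n : ℕ, (1 - x ^ (n + 1))

lemma eta_eq (z : ℂ) : ModularForm.eta z = qParam 24 z * eulerProd (qParam 1 z) := rfl

lemma qParam_pow_eq_of_div_eq {h k : ℝ} {n : ℕ} {z w : ℂ} (hzw : n * z / h = w / k) :
    qParam h z ^ n = qParam k w := by
  rw [qParam, qParam, ← Complex.exp_nat_mul, mul_div_assoc (2 * π * I) w, ← hzw]
  ring_nf

lemma weberF_eq (z : ℂ) : weberF z = (qParam 48 z)⁻¹ *
    (eulerProd (-qParam 48 z ^ 24) / eulerProd (qParam 48 z ^ 48)) := by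
  have h1 : qParam 1 z = qParam 48 z ^ 48 := (qParam_pow_eq_of_div_eq (by push_cast; ring)).symm
  have h24 : qParam 24 z = qParam 48 z ^ 2 := (qParam_pow_eq_of_div_eq (by push_cast; ring)).symm
  have h1_half : qParam 1 ((z + 1) / 2) = -qParam 48 z ^ 24 := by
    rw [show (z + 1) / 2 = z / 2 + 1 / 2 by ring, qParam_add,
      ← qParam_pow_eq_of_div_eq (h := 48) (n := 24) (z := z) (by push_cast; ring),
      show qParam 1 (1 / 2) = -1 by rw [qParam, ← Complex.exp_pi_mul_I]; congr 1; push_cast; ring,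
      mul_neg_one]
  have h24_half : qParam 24 ((z + 1) / 2) = cexp (2 * π * I / 48) * qParam 48 z := by
    simp only [qParam, ← Complex.exp_add]
    congr 1; push_cast; ring
  rw [weberF, eta_eq, eta_eq, h1, h24, h1_half, h24_half]
  have := Complex.exp_ne_zero (2 * π * I / 48)
  have := qParam_ne_zero (h := 48) z
  field_simp

local notation "I∞" => comap Complex.im atTop

lemma differentiableOn_eulerProd : DifferentiableOn ℂ eulerProd (Metric.ball 0 1) :=
  ModularForm.differentiableOn_tprod_one_sub_pow

lemma eulerProd_zero : eulerProd 0 = 1 := by simp [eulerProd]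

lemma tendsto_eulerProd : Tendsto eulerProd (𝓝 0) (𝓝 1) := by
  simpa only [eulerProd_zero] using (differentiableOn_eulerProd.differentiableAt
    (Metric.ball_mem_nhds 0 one_pos)).continuousAt.tendsto

lemma tendsto_qParam_zero {h : ℝ} (hh : 0 < h) : Tendsto (qParam h) I∞ (𝓝 0) :=
  (qParam_tendsto hh).mono_right nhdsWithin_le_nhds

lemma tendsto_qParam_mul_weberF : Tendsto (fun z => qParam 48 z * weberF z) I∞ (𝓝 1) := by
  have hq := tendsto_qParam_zero (h := 48) (by norm_num)
  have hnum : Tendsto (fun z => eulerProd (-qParam 48 z ^ 24)) I∞ (𝓝 1) :=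
    tendsto_eulerProd.comp (by simpa using (hq.pow 24).neg)
  have hden : Tendsto (fun z => eulerProd (qParam 48 z ^ 48)) I∞ (𝓝 1) :=
    tendsto_eulerProd.comp (by simpa using hq.pow 48)
  have hquot := hnum.div hden one_ne_zero
  rw [div_one] at hquot
  refine hquot.congr fun z => ?_
  rw [weberF_eq, mul_inv_cancel_left₀ (qParam_ne_zero z), Pi.div_apply]

lemma tendsto_im_mul_add_const {a : ℝ} (ha : 0 < a) (b : ℂ) :
    Tendsto (fun z : ℂ => a * z + b) I∞ I∞ := by
  have him : Complex.im ∘ (fun z : ℂ => a * z + b) = fun z => a * z.im + b.im := by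
    ext z
    simp
  rw [tendsto_comap_iff, him]
  exact tendsto_atTop_add_const_right _ _ (tendsto_comap.const_mul_atTop ha)

lemma tendsto_im_natCast_mul {n : ℕ} (hn : 0 < n) : Tendsto (fun z : ℂ => (n : ℂ) * z) I∞ I∞ := by
  simpa using tendsto_im_mul_add_const (Nat.cast_pos.mpr hn) 0

lemma eventually_im_pos : ∀ᶠ z : ℂ in I∞, 0 < z.im :=
  tendsto_comap.eventually (eventually_gt_atTop 0)

instance : NeBot I∞ :=
  NeBot.comap_of_surj atTop_neBot fun y => ⟨⟨0, y⟩, rfl⟩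

lemma weberF_one_sub_inv_pow {z : ℂ} (hz : 0 < z.im) :
    weberF (1 + -1 / z) ^ 24 =
      -(2 ^ 12 * (ModularForm.eta (2 * z) ^ 24 / ModularForm.eta z ^ 24)) := by
  have hz0 := ne_zero_of_im_pos hz
  have h2z : 0 < (2 * z).im := by simpa using hz
  have hhalf : (1 + -1 / z + 1) / 2 = -1 / (2 * z) + 1 := by field_simp; ring
  rw [weberF_pow, hhalf, eta_add_one_pow, add_comm 1, eta_add_one_pow, eta_neg_inv_pow hz,
    eta_neg_inv_pow h2z]
  have := ModularForm.eta_ne_zero hz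
  field_simp

lemma tendsto_zero_of_tendsto_pow_zero {α K : Type*} [NormedDivisionRing K] {l : Filter α}
    {f : α → K} {n : ℕ} (h : Tendsto (fun x => f x ^ n) l (𝓝 0)) : Tendsto f l (𝓝 0) := by
  rw [NormedAddGroup.tendsto_nhds_zero] at h ⊢
  intro ε hε
  filter_upwards [h (ε ^ n) (pow_pos hε n)] with x hx
  rw [norm_pow] at hx
  exact lt_of_pow_lt_pow_left₀ n hε.le hx

lemma tendsto_weberF_one_sub_inv : Tendsto (fun z => weberF (1 + -1 / z)) I∞ (𝓝 0) := by
  have hq := tendsto_qParam_zero (h := 1) (by norm_num)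
  have hnum : Tendsto (fun z => eulerProd (qParam 1 z ^ 2)) I∞ (𝓝 1) :=
    tendsto_eulerProd.comp (by simpa using hq.pow 2)
  have hlim := ((hq.mul ((hnum.div (tendsto_eulerProd.comp hq) one_ne_zero).pow 24)).const_mul
    (2 ^ 12)).neg
  simp only [zero_mul, mul_zero, neg_zero] at hlim
  have hpow : Tendsto (fun z => weberF (1 + -1 / z) ^ 24) I∞ (𝓝 0) := by
    refine hlim.congr' ?_
    filter_upwards [eventually_im_pos] with z hz
    have h1_two : qParam 1 (2 * z) = qParam 1 z ^ 2 :=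
      (qParam_pow_eq_of_div_eq (by push_cast; ring)).symm
    have h24_two : qParam 24 (2 * z) ^ 24 = qParam 1 z ^ 2 := by
      rw [← h1_two]
      exact qParam_pow_eq_of_div_eq (by push_cast; ring)
    have h24 : qParam 24 z ^ 24 = qParam 1 z := qParam_pow_eq_of_div_eq (by push_cast; ring)
    rw [weberF_one_sub_inv_pow hz, eta_eq, eta_eq, mul_pow, mul_pow, h1_two, h24_two, h24]
    have := qParam_ne_zero (h := 1) z
    simp only [Pi.div_apply, div_pow, Function.comp_apply]
    field_simp
  exact tendsto_zero_of_tendsto_pow_zero hpow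

/-! ### The transformation law under `Γ(2)` -/

lemma denom_ne_zero_of_det_pos {a b c d : ℤ} (h : 0 < a * d - b * c) {z : ℂ} (hz : 0 < z.im) :
    (c : ℂ) * z + d ≠ 0 := by
  intro h0
  obtain rfl | hc := eq_or_ne c 0
  · obtain rfl : d = 0 := by simpa using h0
    simp at h
  · have him := congrArg Complex.im h0
    simp [hc, hz.ne'] at him

lemma im_moebius_pos {a b c d : ℤ} (h : 0 < a * d - b * c) {z : ℂ} (hz : 0 < z.im) :
    0 < (((a : ℂ) * z + b) / (c * z + d)).im := by
  have hdet : (0 : ℝ) < a * d - b * c := by exact_mod_cast h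
  rw [Complex.div_im, ← sub_div]
  refine div_pos ?_ (Complex.normSq_pos.mpr (denom_ne_zero_of_det_pos h hz))
  simp only [add_im, mul_im, intCast_re, intCast_im, zero_mul, add_zero, add_re, mul_re, sub_zero]
  nlinarith [mul_pos hdet hz]

lemma weberF_div_two_mul_add_one {w : ℂ} (hw : 0 < w.im) :
    weberF (w / (2 * w + 1)) = zeta24 * weberF w := by
  have hw0 := ne_zero_of_im_pos hw
  have him : 0 < (-1 / w - 2).im := by simpa using im_neg_one_div_pos hw
  have hne := ne_zero_of_im_pos him
  have hS : -1 / (-1 / w - 2) = w / (2 * w + 1) := by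
    have e : -1 / w - 2 = -(2 * w + 1) / w := by field_simp; ring
    have : 2 * w + 1 ≠ 0 := by
      rintro h
      simp [e, h] at hne
    rw [e]
    field_simp
  rw [← hS, weberF_neg_inv him, eq_comm, ← eq_inv_mul_iff_mul_eq₀ zeta24_ne_zero,
    ← weberF_neg_inv hw, ← weberF_add_two, sub_add_cancel]

/-- The exponent modulo `24` of the character by which the matrix `!![a, 2 * b; 2 * c, d]` of `Γ(2)`
acts on the Weber function. The two summands give its values modulo `8` and modulo `3`. -/
def weberExp (a b c d : ℤ) : ℤ :=
  9 * (b * d - a * c + 4 * b * c) + 8 * (b * d * (c ^ 2 - 1) - (a + d) * c)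

lemma modEq_twentyFour_of_zmod {m n : ℤ} (h3 : (m : ZMod 3) = n) (h8 : (m : ZMod 8) = n) :
    m ≡ n [ZMOD 24] := by
  rw [ZMod.intCast_eq_intCast_iff] at h3 h8
  exact (Int.modEq_and_modEq_iff_modEq_mul (by decide)).mp ⟨h3, h8⟩

lemma odd_of_det_eq_one {a b c d : ℤ} (h : a * d - 4 * b * c = 1) : Odd a ∧ Odd d :=
  Int.odd_mul.mp ⟨2 * b * c, by linarith⟩

lemma weberExp_T {a b c d : ℤ} (h : a * d - 4 * b * c = 1) :
    weberExp (a + 4 * c) (b + d) c d ≡ weberExp a b c d + 1 [ZMOD 24] := by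
  apply modEq_twentyFour_of_zmod
  · have key : ∀ a b c d : ZMod 3, a * d - 4 * b * c = 1 →
        9 * ((b + d) * d - (a + 4 * c) * c + 4 * (b + d) * c) +
          8 * ((b + d) * d * (c ^ 2 - 1) - (a + 4 * c + d) * c) =
        9 * (b * d - a * c + 4 * b * c) + 8 * (b * d * (c ^ 2 - 1) - (a + d) * c) + 1 := by
      decide
    simpa [weberExp] using key a b c d (by exact_mod_cast congrArg (Int.cast : ℤ → ZMod 3) h)
  · obtain ⟨-, k, rfl⟩ := odd_of_det_eq_one h
    have key : ∀ c k : ZMod 8, (2 * k + 1) ^ 2 - 4 * c ^ 2 + 4 * (2 * k + 1) * c = 1 := by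
      decide
    have h8 : (8 : ZMod 8) = 0 := rfl
    have h9 : (9 : ZMod 8) = 1 := rfl
    simp only [weberExp]
    push_cast
    linear_combination key c k + (c ^ 2 * (2 * k + 1) ^ 2 - (2 * k + 1) ^ 2 - 4 * c ^ 2) * h8 +
      ((2 * k + 1) ^ 2 - 4 * c ^ 2 + 4 * (2 * k + 1) * c) * h9

lemma weberExp_U {a b c d : ℤ} (h : a * d - 4 * b * c = 1) :
    weberExp a b (c + a) (d + 4 * b) ≡ weberExp a b c d - 1 [ZMOD 24] := by
  apply modEq_twentyFour_of_zmod
  · have key : ∀ a b c d : ZMod 3, a * d - 4 * b * c = 1 →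
        9 * (b * (d + 4 * b) - a * (c + a) + 4 * b * (c + a)) +
          8 * (b * (d + 4 * b) * ((c + a) ^ 2 - 1) - (a + (d + 4 * b)) * (c + a)) =
        9 * (b * d - a * c + 4 * b * c) + 8 * (b * d * (c ^ 2 - 1) - (a + d) * c) - 1 := by
      decide
    simpa [weberExp] using key a b c d (by exact_mod_cast congrArg (Int.cast : ℤ → ZMod 3) h)
  · obtain ⟨⟨k, rfl⟩, -⟩ := odd_of_det_eq_one h
    have key : ∀ b k : ZMod 8, 4 * b ^ 2 - (2 * k + 1) ^ 2 + 4 * b * (2 * k + 1) = -1 := by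
      decide
    have h8 : (8 : ZMod 8) = 0 := rfl
    have h9 : (9 : ZMod 8) = 1 := rfl
    simp only [weberExp]
    push_cast
    linear_combination key b k + (4 * b ^ 2 - (2 * k + 1) ^ 2 + 4 * b * (2 * k + 1)) * h9 +
      (b * (d + 4 * b) * ((c + (2 * k + 1)) ^ 2 - 1) - (2 * k + 1 + d + 4 * b) * (c + (2 * k + 1))
        - b * d * (c ^ 2 - 1) + (2 * k + 1 + d) * c) * h8

/-- `T` and `U` are the left actions of `!![1, 2; 0, 1]` and `!![1, 0; 2, 1]` on
`!![a, 2 * b; 2 * c, d]`. -/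
lemma gammaTwo_induction {P : ℤ → ℤ → ℤ → ℤ → Prop} (one : ∀ b, P 1 b 0 1)
    (neg_one : ∀ b, P (-1) b 0 (-1))
    (T : ∀ {a b c d}, a * d - 4 * b * c = 1 → (P (a + 4 * c) (b + d) c d ↔ P a b c d))
    (U : ∀ {a b c d}, a * d - 4 * b * c = 1 → (P a b (c + a) (d + 4 * b) ↔ P a b c d))
    {a b c d : ℤ} (h : a * d - 4 * b * c = 1) : P a b c d := by
  induction hn : a.natAbs + 2 * c.natAbs using Nat.strong_induction_on generalizing a b c d with
  | _ n ih =>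
  rcases eq_or_ne c 0 with rfl | hc
  · rcases Int.mul_eq_one_iff_eq_one_or_neg_one.mp (show a * d = 1 by linarith) with
      ⟨rfl, rfl⟩ | ⟨rfl, rfl⟩
    exacts [one b, neg_one b]
  -- as `a` is odd, `|a| ≠ |2c|`, so one of the four moves decreases `|a| + |2c|`
  obtain ⟨m, hm⟩ := (odd_of_det_eq_one h).1
  have descent : ((a - 4 * c).natAbs + 2 * c.natAbs < n ∨ (a + 4 * c).natAbs + 2 * c.natAbs < n) ∨
      (a.natAbs + 2 * (c - a).natAbs < n ∨ a.natAbs + 2 * (c + a).natAbs < n) := by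
    omega
  rcases descent with (hlt | hlt) | (hlt | hlt)
  · have hdet : (a - 4 * c) * d - 4 * (b - d) * c = 1 := by linarith
    simpa only [sub_add_cancel] using (T hdet).mpr (ih _ hlt hdet rfl)
  · exact (T h).mp (ih _ hlt (by linarith) rfl)
  · have hdet : a * (d - 4 * b) - 4 * b * (c - a) = 1 := by linarith
    simpa only [sub_add_cancel] using (U hdet).mpr (ih _ hlt hdet rfl)
  · exact (U h).mp (ih _ hlt (by linarith) rfl)

lemma weberF_gammaTwo {a b c d : ℤ} (h : a * d - 4 * b * c = 1) {z : ℂ} (hz : 0 < z.im) :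
    weberF ((a * z + 2 * b) / (2 * c * z + d)) = zeta24 ^ (-weberExp a b c d) * weberF z := by
  have hden {a b c d : ℤ} (h : a * d - 4 * b * c = 1) : 2 * (c : ℂ) * z + d ≠ 0 := by
    simpa using denom_ne_zero_of_det_pos (a := a) (b := 2 * b) (c := 2 * c) (d := d)
      (by linarith) hz
  refine gammaTwo_induction (P := fun a b c d => weberF ((a * z + 2 * b) / (2 * c * z + d)) =
    zeta24 ^ (-weberExp a b c d) * weberF z) (fun b => ?_) (fun b => ?_)
    (fun {a b c d} h => ?_) (fun {a b c d} h => ?_) h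
  · rw [zeta24_zpow_eq_of_modEq (n := -b) (Int.modEq_of_dvd ⟨0, by rw [weberExp]; ring⟩),
      ← weberF_add_two_mul_int]
    simp
  · rw [zeta24_zpow_eq_of_modEq (n := -(-b)) (Int.modEq_of_dvd ⟨0, by rw [weberExp]; ring⟩),
      ← weberF_add_two_mul_int]
    congr 1
    push_cast
    field_simp
    ring
  · have hT : ((a + 4 * c : ℤ) * z + 2 * (b + d : ℤ)) / (2 * c * z + d) =
        (a * z + 2 * b) / (2 * c * z + d) + 2 := by
      rw [div_add' _ _ _ (hden h)]
      push_cast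
      ring
    rw [hT, weberF_add_two, zeta24_zpow_eq_of_modEq (weberExp_T h).neg, neg_add_rev,
      zpow_add₀ zeta24_ne_zero, zpow_neg_one, mul_assoc zeta24⁻¹,
      mul_right_inj' (inv_ne_zero zeta24_ne_zero)]
  · set w := (a * z + 2 * b) / (2 * c * z + d) with hw
    have him : 0 < w.im := by
      simpa using im_moebius_pos (a := a) (b := 2 * b) (c := 2 * c) (d := d) (by linarith) hz
    have hU : (a * z + 2 * b) / (2 * (c + a : ℤ) * z + (d + 4 * b : ℤ)) = w / (2 * w + 1) := by
      have h1 : 2 * w + 1 = (2 * (c + a : ℤ) * z + (d + 4 * b : ℤ)) / (2 * c * z + d) := by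
        rw [hw, mul_div_assoc', div_add_one (hden h)]
        push_cast
        ring
      rw [h1, hw, div_div_div_cancel_right₀ (hden h)]
    rw [hU, weberF_div_two_mul_add_one him, zeta24_zpow_eq_of_modEq (weberExp_U h).neg, neg_sub,
      sub_eq_add_neg, zpow_one_add₀ zeta24_ne_zero, mul_assoc, mul_right_inj' zeta24_ne_zero]

lemma norm_weberF_gammaTwo {a b c d : ℤ} (h : a * d - 4 * b * c = 1) {z : ℂ} (hz : 0 < z.im) :
    ‖weberF ((a * z + 2 * b) / (2 * c * z + d))‖ = ‖weberF z‖ := by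
  rw [weberF_gammaTwo h hz, norm_mul, norm_zpow, norm_zeta24, one_zpow, one_mul]

lemma weberF_gamma_fortyeight {a b c d : ℤ} (h : a * d - 48 * b * (48 * c) = 1) {z : ℂ}
    (hz : 0 < z.im) : weberF ((a * z + 48 * b) / (48 * c * z + d)) = weberF z := by
  have hlaw := weberF_gammaTwo (a := a) (b := 24 * b) (c := 24 * c) (d := d) (by linarith) hz
  have hexp : -weberExp a (24 * b) (24 * c) d ≡ 0 [ZMOD 24] :=
    (Int.modEq_zero_iff_dvd.mpr (by rw [weberExp]; ring_nf; omega))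
  rw [zeta24_zpow_eq_of_modEq hexp, zpow_zero, one_mul] at hlaw
  rw [← hlaw]
  push_cast
  ring_nf

lemma exists_mul_even_sub_mul_eq_one {p r : ℤ} (h : IsCoprime p r) (hr : Odd r) :
    ∃ u v : ℤ, p * (2 * v) - r * u = 1 := by
  obtain ⟨x, y, hxy⟩ := h
  rcases Int.even_or_odd' x with ⟨v, rfl | hv⟩
  · exact ⟨-y, v, by linarith⟩
  · obtain ⟨m, hm⟩ := hr
    exact ⟨p - y, v + m + 1, by
      rw [show 2 * (v + m + 1) = x + r by rw [hv, hm]; ring]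
      linear_combination hxy⟩

lemma tendsto_weberF_odd_cusp_of_isCoprime {p q r s g : ℤ} (hp : Odd p) (hr : Odd r)
    (hpr : IsCoprime p r) (hg : 0 < g) (hdet : 0 < p * s - q * r) :
    Tendsto (fun z : ℂ => weberF ((p * g * z + q) / (r * g * z + s))) I∞ (𝓝 0) := by
  -- `!![p, u; r, 2 * v]` maps `∞` to `p / r` and is an element of `Γ(2)` times `!![1, -1; 1, 0]`
  obtain ⟨u, v, huv⟩ := exists_mul_even_sub_mul_eq_one hpr hr
  obtain ⟨b, hb⟩ : Even (p + u) := by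
    have : Odd (r * u) := ⟨p * v - 1, by linarith⟩
    exact hp.add_odd (Int.odd_mul.mp this).2
  have hD : (0 : ℝ) < p * s - q * r := by exact_mod_cast hdet
  have hD0 : (p : ℂ) * s - q * r ≠ 0 := by exact_mod_cast hdet.ne'
  have huv' : (p : ℂ) * (2 * v) - r * u = 1 := by exact_mod_cast huv
  have hb' : (p : ℂ) + u = b + b := by exact_mod_cast hb
  set w : ℂ → ℂ := fun z =>
    (g / (p * s - q * r) : ℝ) * z + (2 * v * q - u * s) / (p * s - q * r) with hw_def
  have hw : Tendsto w I∞ I∞ := tendsto_im_mul_add_const (div_pos (by exact_mod_cast hg) hD) _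
  rw [tendsto_zero_iff_norm_tendsto_zero]
  refine (tendsto_zero_iff_norm_tendsto_zero.mp (tendsto_weberF_one_sub_inv.comp hw)).congr' ?_
  filter_upwards [hw.eventually eventually_im_pos] with z hwz
  have hw0 := ne_zero_of_im_pos hwz
  have him : 0 < (1 + -1 / w z).im := by simpa using im_neg_one_div_pos hwz
  have hgamma : ((-u : ℤ) * (1 + -1 / w z) + 2 * b) / (2 * (-v : ℤ) * (1 + -1 / w z) +
      (r + 2 * v : ℤ)) = (p * w z + u) / (r * w z + 2 * v) := by
    rw [← mul_div_mul_right _ _ hw0]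
    congr 1 <;> push_cast <;> field_simp
    · linear_combination -w z * hb'
    · ring
  have hmoebius : (p * w z + u) / (r * w z + 2 * v) = (p * g * z + q) / (r * g * z + s) := by
    have hwD : w z * (p * s - q * r) = g * z + (2 * v * q - u * s) := by
      simp only [hw_def]
      push_cast
      field_simp
    rw [← mul_div_mul_right _ _ hD0]
    congr 1
    · linear_combination p * hwD + q * huv'
    · linear_combination r * hwD + s * huv'
  rw [Function.comp_apply, ← norm_weberF_gammaTwo (a := -u) (b := b) (c := -v) (d := r + 2 * v)
    (by linear_combination huv - 2 * v * hb) him, hgamma, hmoebius]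

/-- Such a cusp is equivalent under `Γ(2)` to the cusp `1`, where `𝔣` vanishes. -/
lemma tendsto_weberF_odd_cusp {p q r s : ℤ} (hp : Odd p) (hr : Odd r) (hdet : 0 < p * s - q * r) :
    Tendsto (fun z : ℂ => weberF ((p * z + q) / (r * z + s))) I∞ (𝓝 0) := by
  have hp0 : p ≠ 0 := by
    rintro rfl
    simp at hp
  obtain ⟨g, p', r', hg, hpr, rfl, rfl⟩ :=
    Int.exists_gcd_one' (Int.gcd_pos_of_ne_zero_left r hp0)
  have hdet' : 0 < p' * s - q * r' := by
    have : 0 < (p' * s - q * r') * g := by linarith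
    exact pos_of_mul_pos_left this (by positivity)
  simpa using tendsto_weberF_odd_cusp_of_isCoprime (g := g) (Int.odd_mul.mp hp).1
    (Int.odd_mul.mp hr).1 (Int.isCoprime_iff_gcd_eq_one.mpr hpr) (by exact_mod_cast hg) hdet'

/-! ### The conjugates of `𝔣(ℓτ)` -/

/-- The `ℓ + 1` conjugates of `𝔣(ℓτ)` over the field generated by `𝔣(τ)`: `none` stands for `𝔣(ℓτ)`
itself and `some k` for `𝔣((τ + 48 k) / ℓ)`. -/
def weberConj (ℓ : ℕ) : Option (ZMod ℓ) → ℂ → ℂ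
  | none, z => weberF (ℓ * z)
  | some k, z => weberF ((z + 48 * (k.val : ℂ)) / ℓ)

lemma weberConj_intCast {ℓ : ℕ} [NeZero ℓ] (m : ℤ) (z : ℂ) :
    weberConj ℓ (some (m : ZMod ℓ)) z = weberF ((z + 48 * m) / ℓ) := by
  have hℓ : (ℓ : ℂ) ≠ 0 := NeZero.ne _
  obtain ⟨t, ht⟩ := (ZMod.intCast_eq_intCast_iff_dvd_sub ((m : ZMod ℓ).val : ℤ) m ℓ).mp (by simp)
  have hm : (m : ℂ) = ((m : ZMod ℓ).val : ℂ) + ℓ * t := by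
    exact_mod_cast eq_add_of_sub_eq' ht
  rw [weberConj, hm, ← weberF_add_int_of_dvd (m := 48 * t) ⟨t, rfl⟩]
  congr 1
  push_cast
  field_simp
  ring

lemma weberConj_zero (ℓ : ℕ) [NeZero ℓ] (z : ℂ) : weberConj ℓ (some 0) z = weberF (z / ℓ) := by
  simpa using weberConj_intCast (ℓ := ℓ) 0 z

lemma im_add_div_pos {ℓ : ℕ} [NeZero ℓ] (m : ℤ) {z : ℂ} (hz : 0 < z.im) :
    0 < ((z + 48 * m) / ℓ).im := by
  simpa using div_pos hz (Nat.cast_pos.mpr (NeZero.pos ℓ))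

lemma differentiableAt_weberConj {ℓ : ℕ} [NeZero ℓ] (i : Option (ZMod ℓ)) {z : ℂ}
    (hz : 0 < z.im) : DifferentiableAt ℂ (weberConj ℓ i) z := by
  rcases i with _ | k
  · exact (differentiableAt_weberF (im_nat_mul_pos (NeZero.pos ℓ) hz)).comp z
      (f := fun z : ℂ => (ℓ : ℂ) * z) (by fun_prop)
  · exact (differentiableAt_weberF (z := (z + 48 * (k.val : ℂ)) / ℓ)
      (mod_cast im_add_div_pos (k.val : ℤ) hz)).comp z
      (f := fun z : ℂ => (z + 48 * (k.val : ℂ)) / ℓ) (by fun_prop)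

/-- The permutation of the conjugates induced by `τ ↦ -1/τ`. -/
def negInvPerm (ℓ : ℕ) [Fact ℓ.Prime] : Option (ZMod ℓ) → Option (ZMod ℓ)
  | none => some 0
  | some k => if k = 0 then none else some (-(48 ^ 2)⁻¹ * k⁻¹)

lemma fortyeight_ne_zero {ℓ : ℕ} [Fact ℓ.Prime] (h48 : ℓ.Coprime 48) : (48 : ZMod ℓ) ≠ 0 := by
  exact_mod_cast ((ZMod.isUnit_iff_coprime 48 ℓ).mpr h48.symm).ne_zero

lemma negInvPerm_involutive {ℓ : ℕ} [Fact ℓ.Prime] (h48 : ℓ.Coprime 48) :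
    Function.Involutive (negInvPerm ℓ) := by
  have h := fortyeight_ne_zero h48
  rintro (_ | k)
  · simp [negInvPerm]
  · by_cases hk : k = 0
    · simp [negInvPerm, hk]
    · have hk' : -(48 ^ 2)⁻¹ * k⁻¹ ≠ 0 := by simp [h, hk]
      simp only [negInvPerm, hk, hk', if_false, Option.some.injEq]
      field_simp

lemma weberF_neg_inv_add_div {ℓ : ℕ} [NeZero ℓ] {m n t : ℤ} (ht : 48 * m * (48 * n) + 1 = ℓ * t)
    {z : ℂ} (hz : 0 < z.im) : weberF ((-1 / z + 48 * m) / ℓ) = weberF ((z + 48 * n) / ℓ) := by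
  have hℓ : (ℓ : ℂ) ≠ 0 := NeZero.ne _
  have hz0 := ne_zero_of_im_pos hz
  have htC : 48 * (m : ℂ) * (48 * n) + 1 = ℓ * t := by exact_mod_cast ht
  rw [← weberF_neg_inv (im_add_div_pos m (im_neg_one_div_pos hz)),
    ← weberF_gamma_fortyeight (a := -ℓ) (b := n) (c := m) (d := -t) (by linarith)
      (im_add_div_pos n hz)]
  congr 1
  have hnum : ((-ℓ : ℤ) : ℂ) * ((z + 48 * n) / ℓ) + 48 * n = -z := by
    push_cast
    field_simp
    ring
  have hden : 48 * (m : ℂ) * ((z + 48 * n) / ℓ) + ((-t : ℤ) : ℂ) = (48 * m * z - 1) / ℓ := by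
    push_cast
    field_simp
    linear_combination htC
  have hleft : -1 / z + 48 * (m : ℂ) = (48 * m * z - 1) / z := by
    field_simp
    ring
  rw [hnum, hden, hleft, div_right_comm, div_div_eq_mul_div, neg_one_mul]

lemma weberConj_neg_inv {ℓ : ℕ} [Fact ℓ.Prime] (h48 : ℓ.Coprime 48) (i : Option (ZMod ℓ)) {z : ℂ}
    (hz : 0 < z.im) : weberConj ℓ i (-1 / z) = weberConj ℓ (negInvPerm ℓ i) z := by
  have hz0 := ne_zero_of_im_pos hz
  rcases i with _ | k
  · rw [negInvPerm, weberConj_zero,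
      ← weberF_neg_inv (by simpa using im_add_div_pos (ℓ := ℓ) 0 hz), weberConj]
    congr 1
    field_simp
  by_cases hk : k = 0
  · rw [hk, weberConj_zero, negInvPerm, if_pos rfl, weberConj,
      ← weberF_neg_inv (im_nat_mul_pos (NeZero.pos ℓ) hz)]
    congr 1
    field_simp
  · obtain ⟨n, hn⟩ := ZMod.intCast_surjective (-(48 ^ 2)⁻¹ * k⁻¹)
    obtain ⟨m, rfl⟩ := ZMod.intCast_surjective k
    have hdvd : (ℓ : ℤ) ∣ 48 * m * (48 * n) + 1 := by
      rw [← ZMod.intCast_zmod_eq_zero_iff_dvd]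
      have := fortyeight_ne_zero h48
      push_cast
      rw [hn]
      field_simp
      ring
    obtain ⟨t, ht⟩ := hdvd
    simp only [negInvPerm, hk, if_false]
    rw [← hn, weberConj_intCast, weberConj_intCast, weberF_neg_inv_add_div ht hz]

/-- The permutation of the conjugates induced, up to a root of unity, by `τ ↦ τ + 2`. -/
def addTwoPerm (ℓ : ℕ) : Option (ZMod ℓ) ≃ Option (ZMod ℓ) :=
  Equiv.optionCongr (Equiv.subRight (((ℓ ^ 2 - 1) / 24 : ℤ) : ZMod ℓ))

lemma twentyFour_dvd_sq_sub_one {ℓ : ℕ} (h48 : ℓ.Coprime 48) : (24 : ℤ) ∣ (ℓ : ℤ) ^ 2 - 1 := by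
  have hunit : IsUnit (ℓ : ZMod 24) :=
    (ZMod.isUnit_iff_coprime ℓ 24).mpr (h48.coprime_dvd_right (by norm_num))
  have key : ∀ x y : ZMod 24, x * y = 1 → x ^ 2 - 1 = 0 := by decide
  obtain ⟨y, hy⟩ := hunit.exists_right_inv
  refine (ZMod.intCast_zmod_eq_zero_iff_dvd _ 24).mp ?_
  exact_mod_cast key _ y hy

lemma weberConj_add_two {ℓ : ℕ} [NeZero ℓ] (h48 : ℓ.Coprime 48) (i : Option (ZMod ℓ)) (z : ℂ) :
    weberConj ℓ i (z + 2) = (zeta24 ^ ℓ)⁻¹ * weberConj ℓ (addTwoPerm ℓ i) z := by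
  have hℓ : (ℓ : ℂ) ≠ 0 := NeZero.ne _
  have hshift (w : ℂ) : (zeta24 ^ ℓ)⁻¹ * weberF w = weberF (w + 2 * ℓ) := by
    simpa using (weberF_add_two_mul_int ℓ w).symm
  rcases i with _ | k
  · simp only [addTwoPerm, weberConj, Equiv.optionCongr_apply, Option.map_none]
    rw [hshift]
    ring_nf
  · obtain ⟨m, rfl⟩ := ZMod.intCast_surjective k
    obtain ⟨t, ht⟩ := twentyFour_dvd_sq_sub_one h48
    have hperm : addTwoPerm ℓ (some (m : ZMod ℓ)) = some ((m - t : ℤ) : ZMod ℓ) := by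
      simp [addTwoPerm, ht]
    have htC : (ℓ : ℂ) ^ 2 - 1 = 24 * t := by exact_mod_cast congrArg (Int.cast : ℤ → ℂ) ht
    rw [hperm, weberConj_intCast, weberConj_intCast, hshift]
    congr 1
    push_cast
    field_simp
    linear_combination (-2) * htC

lemma weberConj_add_fortyeight {ℓ : ℕ} [NeZero ℓ] (i : Option (ZMod ℓ)) (z : ℂ) :
    weberConj ℓ i (z + 48) = weberConj ℓ (Equiv.optionCongr (Equiv.addRight 1) i) z := by
  rcases i with _ | k
  · simp only [weberConj, Equiv.optionCongr_apply, Option.map_none]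
    rw [← weberF_add_int_of_dvd (m := 48 * ℓ) ⟨ℓ, rfl⟩ (ℓ * z)]
    push_cast
    ring_nf
  · obtain ⟨m, rfl⟩ := ZMod.intCast_surjective k
    have hperm : Equiv.optionCongr (Equiv.addRight (1 : ZMod ℓ)) (some (m : ZMod ℓ)) =
        some ((m + 1 : ℤ) : ZMod ℓ) := by simp
    rw [hperm, weberConj_intCast, weberConj_intCast]
    push_cast
    ring_nf

lemma tendsto_weberConj_one_sub_inv {ℓ : ℕ} [NeZero ℓ] (hodd : Odd ℓ) (i : Option (ZMod ℓ)) :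
    Tendsto (fun z => weberConj ℓ i (1 + -1 / z)) I∞ (𝓝 0) := by
  have hℓ : 0 < ℓ := NeZero.pos ℓ
  have hℓodd : Odd (ℓ : ℤ) := by exact_mod_cast hodd
  rcases i with _ | k
  · refine (tendsto_weberF_odd_cusp (q := -ℓ) (s := 0) hℓodd odd_one (by simpa)).congr' ?_
    filter_upwards [eventually_im_pos] with z hz
    have := ne_zero_of_im_pos hz
    rw [weberConj]
    congr 1
    push_cast
    rw [one_mul, add_zero]
    field_simp
  · obtain ⟨m, rfl⟩ := ZMod.intCast_surjective k
    have hmodd : Odd (48 * m + 1) := ⟨24 * m, by ring⟩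
    refine (tendsto_weberF_odd_cusp (q := -1) (s := 0) hmodd hℓodd (by simpa)).congr' ?_
    filter_upwards [eventually_im_pos] with z hz
    have := ne_zero_of_im_pos hz
    have : (ℓ : ℂ) ≠ 0 := NeZero.ne _
    rw [weberConj_intCast]
    congr 1
    push_cast
    field_simp
    ring

lemma tendsto_weberConj_none {ℓ : ℕ} [NeZero ℓ] :
    Tendsto (fun z => qParam 48 z ^ ℓ * weberConj ℓ none z) I∞ (𝓝 1) := by
  refine (tendsto_qParam_mul_weberF.comp (tendsto_im_natCast_mul (NeZero.pos ℓ))).congr fun z => ?_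
  rw [weberConj, qParam_pow_eq_of_div_eq rfl, Function.comp_apply]

lemma tendsto_weberConj_some {ℓ : ℕ} [NeZero ℓ] (k : ZMod ℓ) :
    Tendsto (fun z => qParam 48 (z / ℓ) * weberConj ℓ (some k) z) I∞
      (𝓝 (cexp (2 * π * I / ℓ) ^ k.val)⁻¹) := by
  have hℓ : (0 : ℝ) < (ℓ : ℝ)⁻¹ := inv_pos.mpr (Nat.cast_pos.mpr (NeZero.pos ℓ))
  have hne : cexp (2 * π * I / ℓ) ^ k.val ≠ 0 := pow_ne_zero _ (Complex.exp_ne_zero _)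
  have h := (tendsto_qParam_mul_weberF.comp
    (tendsto_im_mul_add_const hℓ (48 * (k.val : ℂ) / ℓ))).const_mul (cexp (2 * π * I / ℓ) ^ k.val)⁻¹
  rw [mul_one] at h
  refine h.congr fun z => ?_
  have hz : ((ℓ : ℝ)⁻¹ : ℝ) * z + 48 * (k.val : ℂ) / ℓ = z / ℓ + 48 * (k.val : ℂ) / ℓ := by
    push_cast
    ring
  have hk : qParam 48 (48 * (k.val : ℂ) / ℓ) = cexp (2 * π * I / ℓ) ^ k.val := by
    rw [qParam, ← Complex.exp_nat_mul]
    congr 1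
    push_cast
    ring
  rw [Function.comp_apply, hz, qParam_add, hk, weberConj, add_div]
  field_simp

lemma tendsto_weberConj_some_zero {ℓ : ℕ} (hℓ : 1 < ℓ) (k : ZMod ℓ) :
    Tendsto (fun z => qParam 48 z ^ ℓ * weberConj ℓ (some k) z) I∞ (𝓝 0) := by
  have : NeZero ℓ := ⟨by omega⟩
  have hpos : (0 : ℝ) < 48 * ℓ := by positivity
  have hne : ℓ ^ 2 - 1 ≠ 0 := (Nat.sub_pos_of_lt (Nat.one_lt_pow two_ne_zero hℓ)).ne'
  have hlim := ((tendsto_qParam_zero hpos).pow (ℓ ^ 2 - 1)).mul (tendsto_weberConj_some k)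
  rw [zero_pow hne, zero_mul] at hlim
  refine hlim.congr fun z => ?_
  have hℓC : (ℓ : ℂ) ≠ 0 := NeZero.ne _
  have h1 : qParam (48 * ℓ) z ^ ℓ = qParam 48 z := qParam_pow_eq_of_div_eq (by
    push_cast; field_simp)
  have h2 : qParam 48 (z / ℓ) = qParam (48 * ℓ) z := by
    rw [← pow_one (qParam 48 (z / ℓ))]
    exact qParam_pow_eq_of_div_eq (by push_cast; field_simp)
  rw [h2, ← mul_assoc, ← pow_succ, Nat.sub_add_cancel (Nat.one_le_pow _ _ (NeZero.pos ℓ)), sq,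
    pow_mul, h1]

lemma eventually_ne_of_tendsto_mul {α : Type*} {l : Filter α} {f g u : α → ℂ} {a b : ℂ}
    (hf : Tendsto (fun z => u z * f z) l (𝓝 a)) (hg : Tendsto (fun z => u z * g z) l (𝓝 b))
    (hab : a ≠ b) : ∀ᶠ z in l, f z ≠ g z := by
  filter_upwards [(hf.sub hg).eventually_ne (sub_ne_zero.mpr hab)] with z hz h
  exact hz (by rw [h, sub_self])

lemma eventually_injective_weberConj {ℓ : ℕ} (hℓ : 1 < ℓ) :
    ∀ᶠ z in I∞, Function.Injective fun i => weberConj ℓ i z := by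
  have : NeZero ℓ := ⟨by omega⟩
  have hnone (k : ZMod ℓ) : ∀ᶠ z in I∞, weberConj ℓ none z ≠ weberConj ℓ (some k) z :=
    eventually_ne_of_tendsto_mul tendsto_weberConj_none (tendsto_weberConj_some_zero hℓ k)
      one_ne_zero
  have hsome {k k' : ZMod ℓ} (hne : k ≠ k') :
      ∀ᶠ z in I∞, weberConj ℓ (some k) z ≠ weberConj ℓ (some k') z := by
    refine eventually_ne_of_tendsto_mul (tendsto_weberConj_some k) (tendsto_weberConj_some k')
      fun h => hne (ZMod.val_injective ℓ ?_)
    exact (Complex.isPrimitiveRoot_exp ℓ (NeZero.ne ℓ)).pow_inj (ZMod.val_lt k) (ZMod.val_lt k')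
      (inv_injective h)
  have hpair (i j : Option (ZMod ℓ)) : ∀ᶠ z in I∞, i ≠ j → weberConj ℓ i z ≠ weberConj ℓ j z := by
    rw [eventually_imp_distrib_left]
    rcases i with _ | k <;> rcases j with _ | k' <;> intro hne
    · exact absurd rfl hne
    · exact hnone k'
    · exact (hnone k).mono fun z => Ne.symm
    · exact hsome fun h => hne (congrArg some h)
  filter_upwards [eventually_all.mpr fun i => eventually_all.mpr (hpair i)] with z hz i j
  exact Function.mtr (hz i j)

/-! ### Functions for the theta group -/

/-- A holomorphic function on the upper half-plane which is multiplied by `c` under `τ ↦ τ + 2`,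
invariant under `τ ↦ -1/τ`, and bounded at the cusp `1` of the theta group. Nothing is required at
the cusp `∞`. -/
structure IsThetaFunction (c : ℂ) (h : ℂ → ℂ) : Prop where
  differentiableAt {z : ℂ} (hz : 0 < z.im) : DifferentiableAt ℂ h z
  add_two (z : ℂ) : h (z + 2) = c * h z
  neg_inv {z : ℂ} (hz : 0 < z.im) : h (-1 / z) = h z
  boundedAtCuspOne : BoundedAtFilter I∞ fun z => h (1 + -1 / z)

section LevelOne

open scoped MatrixGroups

lemma slash_zero_eq_self {G : ℂ → ℂ} (hT : ∀ z : ℂ, 0 < z.im → G (z + 1) = G z)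
    (hS : ∀ z : ℂ, 0 < z.im → G (-1 / z) = G z) (γ : SL(2, ℤ)) :
    SlashAction.map (0 : ℤ) γ (fun τ : UpperHalfPlane => G τ) =
      fun τ : UpperHalfPlane => G τ := by
  refine SlashInvariantForm.slash_action_generators_SL2Z ?_ ?_ γ
  · ext τ
    rw [ModularForm.SL_slash_apply, UpperHalfPlane.modular_S_smul]
    simpa [neg_div] using hS τ τ.2
  · ext τ
    rw [ModularForm.SL_slash_apply, UpperHalfPlane.modular_T_smul]
    simpa [add_comm] using hT τ τ.2

lemma eq_zero_of_levelOne {G : ℂ → ℂ} (hd : ∀ z : ℂ, 0 < z.im → DifferentiableAt ℂ G z)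
    (hT : ∀ z : ℂ, 0 < z.im → G (z + 1) = G z) (hS : ∀ z : ℂ, 0 < z.im → G (-1 / z) = G z)
    (h0 : Tendsto G I∞ (𝓝 0)) {z : ℂ} (hz : 0 < z.im) : G z = 0 := by
  have hlim : Tendsto (fun τ : UpperHalfPlane => G τ) UpperHalfPlane.atImInfty (𝓝 0) :=
    h0.comp UpperHalfPlane.tendsto_coe_atImInfty
  let F : ModularForm 𝒮ℒ 0 :=
    { toFun τ := G τ
      slash_action_eq' := by
        rintro _ ⟨γ, rfl⟩
        exact slash_zero_eq_self hT hS γ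
      holo' := by
        refine UpperHalfPlane.mdifferentiable_iff.mpr <| DifferentiableOn.congr (f := G)
          (fun z hz => (hd z hz).differentiableWithinAt) fun z hz => ?_
        simp [UpperHalfPlane.ofComplex_apply_of_im_pos hz]
      bdd_at_cusps' := by
        intro c hc
        rw [Subgroup.IsArithmetic.isCusp_iff_isCusp_SL2Z] at hc
        rw [OnePoint.isBoundedAt_iff_forall_SL2Z hc]
        intro γ _
        rw [slash_zero_eq_self hT hS γ]
        exact ZeroAtFilter.boundedAtFilter hlim }
  obtain ⟨c, hc⟩ := ModularFormClass.levelOne_weight_zero_const F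
  have hconst (τ : UpperHalfPlane) : G τ = c := congrFun hc τ
  have hc0 : c = 0 := tendsto_nhds_unique (tendsto_const_nhds.congr fun τ => (hconst τ).symm) hlim
  exact (hconst ⟨z, hz⟩).trans hc0

end LevelOne

lemma analyticOnNhd_of_differentiableAt {h : ℂ → ℂ}
    (hd : ∀ z : ℂ, 0 < z.im → DifferentiableAt ℂ h z) : AnalyticOnNhd ℂ h upperHalfPlaneSet :=
  DifferentiableOn.analyticOnNhd (fun z hz => (hd z hz).differentiableWithinAt)
    isOpen_upperHalfPlaneSet

lemma eq_zero_or_eq_zero_of_mul_eq_zero {g h : ℂ → ℂ}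
    (hg : ∀ z : ℂ, 0 < z.im → DifferentiableAt ℂ g z)
    (hh : ∀ z : ℂ, 0 < z.im → DifferentiableAt ℂ h z)
    (hgh : ∀ z : ℂ, 0 < z.im → g z * h z = 0) :
    (∀ z : ℂ, 0 < z.im → g z = 0) ∨ (∀ z : ℂ, 0 < z.im → h z = 0) :=
  AnalyticOnNhd.eq_zero_or_eq_zero_of_mul_eq_zero (analyticOnNhd_of_differentiableAt hg)
    (analyticOnNhd_of_differentiableAt hh) hgh (convex_halfSpace_im_gt 0).isPreconnected

/-- The product of a function over representatives of the three cosets of the theta group in the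
modular group: the norm from the theta group to level one. -/
def thetaNorm (h : ℂ → ℂ) (z : ℂ) : ℂ := h z * h (z + 1) * h (1 + -1 / z)

lemma im_one_add_neg_inv_pos {z : ℂ} (hz : 0 < z.im) : 0 < (1 + -1 / z).im := by
  simpa using im_neg_one_div_pos hz

namespace IsThetaFunction

variable {c : ℂ} {h : ℂ → ℂ}

lemma sub {g : ℂ → ℂ} (hg : IsThetaFunction c g) (hh : IsThetaFunction c h) :
    IsThetaFunction c fun z => g z - h z where
  differentiableAt hz := (hg.differentiableAt hz).sub (hh.differentiableAt hz)
  add_two z := by rw [hg.add_two, hh.add_two, mul_sub]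
  neg_inv hz := by rw [hg.neg_inv hz, hh.neg_inv hz]
  boundedAtCuspOne := IsBigO.sub hg.boundedAtCuspOne hh.boundedAtCuspOne

lemma differentiableAt_add_one (hh : IsThetaFunction c h) {z : ℂ} (hz : 0 < z.im) :
    DifferentiableAt ℂ (fun z => h (z + 1)) z :=
  (hh.differentiableAt (by simpa using hz)).comp z (f := fun z : ℂ => z + 1) (by fun_prop)

lemma differentiableAt_one_sub_inv (hh : IsThetaFunction c h) {z : ℂ} (hz : 0 < z.im) :
    DifferentiableAt ℂ (fun z => h (1 + -1 / z)) z :=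
  (hh.differentiableAt (im_one_add_neg_inv_pos hz)).comp z (f := fun z : ℂ => 1 + -1 / z)
    (((differentiableAt_const _).div differentiableAt_id (ne_zero_of_im_pos hz)).const_add _)

lemma differentiableAt_thetaNorm (hh : IsThetaFunction c h) {z : ℂ} (hz : 0 < z.im) :
    DifferentiableAt ℂ (thetaNorm h) z :=
  ((hh.differentiableAt hz).mul (hh.differentiableAt_add_one hz)).mul
    (hh.differentiableAt_one_sub_inv hz)

lemma thetaNorm_add_one (hh : IsThetaFunction c h) {z : ℂ} (hz : 0 < z.im) :
    thetaNorm h (z + 1) = thetaNorm h z := by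
  have := ne_zero_of_im_pos hz
  have : z + 1 ≠ 0 := ne_zero_of_im_pos (by simpa using hz)
  have hw : 0 < (-1 / z - 1).im := by simpa using im_neg_one_div_pos hz
  have hinv : 1 + -1 / (z + 1) = -1 / (-1 / z - 1) := by
    rw [show -1 / z - 1 = -(z + 1) / z by field_simp; ring]
    field_simp
    ring
  have hshift : h (1 + -1 / z) = c * h (-1 / z - 1) := by
    rw [← hh.add_two]
    ring_nf
  rw [thetaNorm, thetaNorm, hinv, hh.neg_inv hw, hshift, add_assoc, one_add_one_eq_two, hh.add_two]
  ring

lemma thetaNorm_neg_inv (hh : IsThetaFunction c h) {z : ℂ} (hz : 0 < z.im) :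
    thetaNorm h (-1 / z) = thetaNorm h z := by
  have := ne_zero_of_im_pos hz
  have hinv : 1 + -1 / (-1 / z) = z + 1 := by
    field_simp
    ring
  rw [thetaNorm, thetaNorm, hinv, hh.neg_inv hz, add_comm (-1 / z)]
  ring

lemma tendsto_thetaNorm (hh : IsThetaFunction c h) (h0 : Tendsto h I∞ (𝓝 0)) :
    Tendsto (thetaNorm h) I∞ (𝓝 0) := by
  have hadd : Tendsto (fun z : ℂ => z + 1) I∞ I∞ := by
    simpa using tendsto_im_mul_add_const one_pos 1
  have hmul : Tendsto (fun z => h z * h (z + 1)) I∞ (𝓝 0) := by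
    simpa using h0.mul (h0.comp hadd)
  exact ZeroAtFilter.mul_boundedAtFilter hmul hh.boundedAtCuspOne

lemma eq_zero (hh : IsThetaFunction c h) (h0 : Tendsto h I∞ (𝓝 0)) {z : ℂ} (hz : 0 < z.im) :
    h z = 0 := by
  have hnorm (z : ℂ) (hz : 0 < z.im) : thetaNorm h z = 0 :=
    eq_zero_of_levelOne (fun _ => hh.differentiableAt_thetaNorm) (fun _ => hh.thetaNorm_add_one)
      (fun _ => hh.thetaNorm_neg_inv) (hh.tendsto_thetaNorm h0) hz
  have hw : 0 < (z - 1).im := by simpa using hz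
  rcases eq_zero_or_eq_zero_of_mul_eq_zero
    (fun _ hz => (hh.differentiableAt hz).mul (hh.differentiableAt_add_one hz))
    (fun _ => hh.differentiableAt_one_sub_inv) hnorm with hprod | hlast
  · rcases eq_zero_or_eq_zero_of_mul_eq_zero (fun _ => hh.differentiableAt)
      (fun _ => hh.differentiableAt_add_one) hprod with hfirst | hmid
    · exact hfirst z hz
    · simpa using hmid (z - 1) hw
  · have := ne_zero_of_im_pos hw
    have hinv : 1 + -1 / (-1 / (z - 1)) = z := by
      field_simp
      ring
    simpa only [hinv] using hlast _ (im_neg_one_div_pos hw)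

lemma add_two_mul_natCast (hh : IsThetaFunction c h) (n : ℕ) (z : ℂ) :
    h (z + 2 * n) = c ^ n * h z := by
  induction n with
  | zero => simp
  | succ n ih =>
    rw [show z + 2 * ((n + 1 : ℕ) : ℂ) = z + 2 * n + 2 by push_cast; ring, hh.add_two, ih]
    ring

lemma periodic_qParam_pow_mul (hh : IsThetaFunction c h) (hc : c ^ 24 = 1) (N : ℕ) :
    Function.Periodic (fun z => qParam 48 z ^ N * h z) (48 : ℝ) := by
  have hper : Function.Periodic h (48 : ℝ) := fun z => by
    rw [show z + ((48 : ℝ) : ℂ) = z + 2 * (24 : ℕ) by push_cast; ring, hh.add_two_mul_natCast, hc,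
      one_mul]
  have hq : Function.Periodic (qParam 48) (48 : ℝ) := fun z => by
    have hself : qParam 48 (48 : ℝ) = 1 := by simp [qParam]
    rw [qParam_add, hself, mul_one]
  exact (hq.comp (· ^ N)).mul hper

lemma eventually_differentiableAt_qParam_pow_mul (hh : IsThetaFunction c h) (N : ℕ) :
    ∀ᶠ z in I∞, DifferentiableAt ℂ (fun z => qParam 48 z ^ N * h z) z :=
  eventually_im_pos.mono fun z hz => ((differentiable_qParam z).pow N).mul (hh.differentiableAt hz)

lemma boundedAtFilter_of_tendsto_zero (hh : IsThetaFunction c h) (hc : c ^ 24 = 1) {N : ℕ}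
    (hlim : Tendsto (fun z => qParam 48 z ^ (N + 1) * h z) I∞ (𝓝 0)) :
    BoundedAtFilter I∞ fun z => qParam 48 z ^ N * h z := by
  obtain ⟨C, hC⟩ := (exp_decay_of_zero_at_inf (by norm_num) (hh.periodic_qParam_pow_mul hc _)
    (hh.eventually_differentiableAt_qParam_pow_mul _) hlim).bound
  refine IsBigO.of_bound C ?_
  filter_upwards [hC] with z hz
  have hq : 0 < ‖qParam 48 z‖ := norm_pos_iff.mpr (qParam_ne_zero z)
  rw [← norm_qParam, norm_norm, pow_succ', mul_assoc, norm_mul, mul_comm C] at hz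
  simpa using le_of_mul_le_mul_left hz hq

end IsThetaFunction

lemma isThetaFunction_const_mul_weberF_pow {c L : ℂ} {N : ℕ} (hL : L * zeta24⁻¹ ^ N = c * L) :
    IsThetaFunction c fun z => L * weberF z ^ N where
  differentiableAt hz := ((differentiableAt_weberF hz).pow N).const_mul L
  add_two z := by
    rw [weberF_add_two, mul_pow]
    linear_combination weberF z ^ N * hL
  neg_inv hz := by rw [weberF_neg_inv hz]
  boundedAtCuspOne := ((tendsto_weberF_one_sub_inv.pow N).const_mul L).isBigO_one ℝ

namespace IsThetaFunction

variable {c : ℂ} {h : ℂ → ℂ}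

lemma exists_leading_coeff (hh : IsThetaFunction c h) (hc : c ^ 24 = 1) {N : ℕ}
    (hN : BoundedAtFilter I∞ fun z => qParam 48 z ^ N * h z) :
    ∃ L : ℂ, L * zeta24⁻¹ ^ N = c * L ∧
      Tendsto (fun z => qParam 48 z ^ N * (h z - L * weberF z ^ N)) I∞ (𝓝 0) := by
  have hlim := tendsto_at_I_inf (by norm_num) (hh.periodic_qParam_pow_mul hc N)
    (hh.eventually_differentiableAt_qParam_pow_mul N) hN
  set L := cuspFunction 48 (fun z => qParam 48 z ^ N * h z) 0
  refine ⟨L, ?_, ?_⟩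
  · have hadd : Tendsto (fun z : ℂ => z + 2) I∞ I∞ := by
      simpa using tendsto_im_mul_add_const one_pos 2
    have hq (z : ℂ) : qParam 48 (z + 2) = zeta24 * qParam 48 z := by
      rw [qParam_add, mul_comm, zeta24, qParam]
      push_cast
      ring_nf
    have hL : L = zeta24 ^ N * c * L :=
      tendsto_nhds_unique (hlim.comp hadd) <| (hlim.const_mul (zeta24 ^ N * c)).congr fun z => by
        simp only [Function.comp, hq, hh.add_two]
        ring
    have := pow_ne_zero N zeta24_ne_zero
    rw [inv_pow]
    field_simp
    linear_combination hL
  · have hdiff := hlim.sub ((tendsto_qParam_mul_weberF.pow N).const_mul L)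
    rw [one_pow, mul_one, sub_self] at hdiff
    exact hdiff.congr fun z => by rw [mul_pow]; ring

-- Subtracting the leading term `L 𝔣 ^ N` lowers the order of the pole at infinity.
lemma exists_polynomial (hh : IsThetaFunction c h) (hc : c ^ 24 = 1) {N : ℕ}
    (hN : BoundedAtFilter I∞ fun z => qParam 48 z ^ N * h z) :
    ∃ p : Polynomial ℂ, ∀ z : ℂ, 0 < z.im → h z = p.eval (weberF z) := by
  induction N generalizing h with
  | zero =>
    obtain ⟨L, hL, hlim⟩ := hh.exists_leading_coeff hc hN
    have hrest := hh.sub (isThetaFunction_const_mul_weberF_pow hL)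
    refine ⟨Polynomial.C L, fun z hz => ?_⟩
    simpa [sub_eq_zero] using hrest.eq_zero (by simpa using hlim) hz
  | succ N ih =>
    obtain ⟨L, hL, hlim⟩ := hh.exists_leading_coeff hc hN
    have hrest := hh.sub (isThetaFunction_const_mul_weberF_pow hL)
    obtain ⟨p, hp⟩ := ih hrest (hrest.boundedAtFilter_of_tendsto_zero hc hlim)
    refine ⟨p + Polynomial.C L * Polynomial.X ^ (N + 1), fun z hz => ?_⟩
    simp [← hp z hz]

end IsThetaFunction

/-! ### Bivariate polynomials -/

open Polynomial

section Bivariate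

variable {A K L : Type*} [CommRing A] [CommRing K] [CommRing L]

lemma evalEval_eq_sum (Q : K[X][X]) {M : ℕ} (hM : Q.natDegree < M)
    (hM' : ∀ j, (Q.coeff j).natDegree < M) (x y : K) :
    Q.evalEval x y = ∑ p ∈ Finset.range M ×ˢ Finset.range M,
      (Q.coeff p.2).coeff p.1 * (x ^ p.1 * y ^ p.2) := by
  rw [← map_evalRingHom_eval, eval_eq_sum_range' (natDegree_map_le.trans_lt hM),
    Finset.sum_product_right]
  refine Finset.sum_congr rfl fun j _ => ?_
  rw [coeff_map, coe_evalRingHom, eval_eq_sum_range' (hM' j), Finset.sum_mul]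
  exact Finset.sum_congr rfl fun i _ => by ring

lemma exists_natDegree_bound (Q : K[X][X]) :
    ∃ M, Q.natDegree < M ∧ ∀ j, (Q.coeff j).natDegree < M := by
  refine ⟨Q.natDegree + Q.support.sup (fun j => (Q.coeff j).natDegree) + 1, by omega, fun j => ?_⟩
  by_cases hj : j ∈ Q.support
  · have := Finset.le_sup (f := fun j => (Q.coeff j).natDegree) hj
    omega
  · rw [notMem_support_iff.mp hj, natDegree_zero]
    omega

lemma exists_coeff_eq_apply_coeff {R S : Type*} [Semiring R] [Semiring S] {φ : R → S}
    (hφ : φ 0 = 0) (p : R[X]) : ∃ q : S[X], ∀ i, q.coeff i = φ (p.coeff i) := by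
  refine ⟨∑ j ∈ p.support, monomial j (φ (p.coeff j)), fun i => ?_⟩
  by_cases hi : p.coeff i = 0 <;> simp [finsetSum_coeff, coeff_monomial, hi, hφ]

lemma exists_coeff_coeff_eq_apply_coeff_coeff {φ : K → L} (hφ : φ 0 = 0) (Q : K[X][X]) :
    ∃ R : L[X][X], ∀ i j, (R.coeff j).coeff i = φ ((Q.coeff j).coeff i) := by
  choose f hf using exists_coeff_eq_apply_coeff hφ
  have hf0 : f 0 = 0 := by
    ext i
    rw [hf, coeff_zero, hφ, coeff_zero]
  obtain ⟨R, hR⟩ := exists_coeff_eq_apply_coeff hf0 Q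
  exact ⟨R, fun i j => by rw [hR, hf]⟩

/-- The map between rings of bivariate polynomials induced by a map of coefficients. -/
def bivariateMap (f : A →+* K) : A[X][X] →+* K[X][X] :=
  mapRingHom (mapRingHom f)

lemma bivariateMap_injective {f : A →+* K} (hf : Function.Injective f) :
    Function.Injective (bivariateMap f) :=
  map_injective _ (map_injective _ hf)

lemma natDegree_bivariateMap {f : A →+* K} (hf : Function.Injective f) (P : A[X][X]) :
    (bivariateMap f P).natDegree = P.natDegree :=
  natDegree_map_eq_of_injective (map_injective _ hf) P

/-- The substitution `x ↦ a x`, `y ↦ b y`. -/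
def scaleHom (a b : K) : K[X][X] →+* K[X][X] :=
  (compRingHom (C (C b) * X)).comp (mapRingHom (compRingHom (C a * X)))

lemma evalEval_scaleHom (a b x y : K) (Q : K[X][X]) :
    (scaleHom a b Q).evalEval x y = Q.evalEval (a * x) (b * y) := by
  have hcomp : (evalEvalRingHom x y).comp (scaleHom a b) = evalEvalRingHom (a * x) (b * y) := by
    ext <;> simp [scaleHom]
  exact DFunLike.congr_fun hcomp Q

lemma coeff_scaleHom (a b : K) (Q : K[X][X]) (n : ℕ) :
    (scaleHom a b Q).coeff n = (Q.coeff n).comp (C a * X) * C b ^ n := by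
  simp [scaleHom, comp_C_mul_X_coeff]

lemma scaleHom_C_C (a b c : K) : scaleHom a b (C (C c)) = C (C c) := by
  simp [scaleHom]

end Bivariate

lemma prime_algebraMap_of_isLocalization {R S : Type*} [CommRing R] [IsDomain R] [CommRing S]
    [Algebra R S] (M : Submonoid R) [IsLocalization M S] (hM : M ≤ nonZeroDivisors R) {p : R}
    (hp : Prime p) (hpM : ∀ m ∈ M, ¬ p ∣ m) : Prime (algebraMap R S p) := by
  have hne : algebraMap R S p ≠ 0 :=
    (map_ne_zero_iff _ (IsLocalization.injective S hM)).mpr hp.ne_zero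
  rw [← Ideal.span_singleton_prime hne, ← Set.image_singleton, ← Ideal.map_span]
  refine IsLocalization.isPrime_of_isPrime_disjoint M S _
    ((Ideal.span_singleton_prime hp.ne_zero).mpr hp) (Set.disjoint_left.mpr fun m hm h => ?_)
  exact hpM m hm (Ideal.mem_span_singleton.mp h)

/-- The nonzero integers, as a submonoid of `ℤ[x][y]`. -/
def nonzeroIntegers : Submonoid ℤ[X][X] :=
  ((nonZeroDivisors ℤ).map (C : ℤ →+* ℤ[X])).map (C : ℤ[X] →+* ℤ[X][X])

lemma mem_nonzeroIntegers {P : ℤ[X][X]} : P ∈ nonzeroIntegers ↔ ∃ n : ℤ, n ≠ 0 ∧ C (C n) = P := by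
  simp [nonzeroIntegers]

lemma nonzeroIntegers_le_nonZeroDivisors : nonzeroIntegers ≤ nonZeroDivisors ℤ[X][X] := by
  intro P hP
  obtain ⟨n, hn, rfl⟩ := mem_nonzeroIntegers.mp hP
  simpa using hn

attribute [local instance] Polynomial.algebra Polynomial.isLocalization in
lemma isLocalization_nonzeroIntegers :
    @IsLocalization _ _ nonzeroIntegers ℚ[X][X] _ (bivariateMap (Int.castRingHom ℚ)).toAlgebra := by
  exact Polynomial.isLocalization ((nonZeroDivisors ℤ).map (C : ℤ →+* ℤ[X])) ℚ[X]

/-! ### The polynomial of the conjugates -/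

lemma coeff_prod_X_sub_C_mem {ι R : Type*} [CommRing R] {A : Subring R} {s : Finset ι}
    {f : ι → R} (hf : ∀ i ∈ s, f i ∈ A) (n : ℕ) : (∏ i ∈ s, (X - C (f i))).coeff n ∈ A := by
  have hlift : ∏ i ∈ s, (X - C (f i)) ∈ liftsRing A.subtype :=
    (liftsRing A.subtype).prod_mem fun i hi => (lifts_iff_liftsRing _ _).mp <|
      (lifts_iff_coeff_lifts _).mpr fun k => by
        simpa using A.sub_mem (by rw [coeff_X]; split_ifs; exacts [A.one_mem, A.zero_mem])
          (by rw [coeff_C]; split_ifs; exacts [hf i hi, A.zero_mem])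
  obtain ⟨a, ha⟩ := (lifts_iff_coeff_lifts _).mp ((lifts_iff_liftsRing _ _).mpr hlift) n
  exact ha ▸ a.2

lemma coeff_prod_X_sub_C_mul_pow {ι R : Type*} [CommRing R] (s : Finset ι) (f : ι → R) (c : R)
    (n : ℕ) : (∏ i ∈ s, (X - C (c * f i))).coeff n * c ^ n =
      c ^ s.card * (∏ i ∈ s, (X - C (f i))).coeff n := by
  rw [← comp_C_mul_X_coeff, prod_comp, ← coeff_C_mul, ← Finset.prod_const, map_prod,
    ← Finset.prod_mul_distrib]
  congr 1
  exact Finset.prod_congr rfl fun i _ => by simp [mul_sub]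

lemma exists_monic_map_eq {ι R S : Type*} [CommRing R] [CommRing S] [Nontrivial R]
    (φ : ι → R →+* S) {P : ι → S[X]} {d : ℕ} (hmonic : ∀ i, (P i).Monic)
    (hdeg : ∀ i, (P i).natDegree = d) (h : ∀ n, ∃ p, ∀ i, (P i).coeff n = φ i p) :
    ∃ F : R[X], F.Monic ∧ F.natDegree = d ∧ ∀ i, F.map (φ i) = P i := by
  choose p hp using h
  have hlt : (∑ n ∈ Finset.range d, C (p n) * X ^ n).degree < (d : WithBot ℕ) := by
    rw [Finset.sum_range]
    exact degree_sum_fin_lt _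
  refine ⟨X ^ d + ∑ n ∈ Finset.range d, C (p n) * X ^ n, monic_X_pow_add hlt, ?_, fun i => ?_⟩
  · rw [natDegree_add_eq_left_of_degree_lt (by rwa [degree_X_pow]), natDegree_X_pow]
  · rw [(hmonic i).as_sum, hdeg]
    simp [Polynomial.map_sum, hp]

/-- The subring of functions holomorphic on the upper half-plane. -/
def holomorphicSubring : Subring (ℂ → ℂ) where
  carrier := {g | ∀ z : ℂ, 0 < z.im → DifferentiableAt ℂ g z}
  mul_mem' hf hg z hz := (hf z hz).mul (hg z hz)
  one_mem' _ _ := differentiableAt_const _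
  add_mem' hf hg z hz := (hf z hz).add (hg z hz)
  zero_mem' _ _ := differentiableAt_const _
  neg_mem' hf z hz := (hf z hz).neg

/-- The subring of functions bounded at the cusp `1`. -/
def boundedAtCuspOneSubring : Subring (ℂ → ℂ) where
  carrier := {g | BoundedAtFilter I∞ fun z => g (1 + -1 / z)}
  mul_mem' hf hg := BoundedAtFilter.mul hf hg
  one_mem' := const_boundedAtFilter _ _
  add_mem' hf hg := BoundedAtFilter.add hf hg
  zero_mem' := const_boundedAtFilter _ _
  neg_mem' hf := BoundedAtFilter.neg hf

lemma boundedAtFilter_qParam_pow (N : ℕ) : BoundedAtFilter I∞ fun z => qParam 48 z ^ N :=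
  ((tendsto_qParam_zero (h := 48) (by norm_num)).pow N).isBigO_one ℝ

/-- The subring of functions which grow at the cusp `∞` at most like a power of `q⁻¹`. -/
def moderateGrowthSubring : Subring (ℂ → ℂ) where
  carrier := {g | ∃ N : ℕ, BoundedAtFilter I∞ fun z => qParam 48 z ^ N * g z}
  mul_mem' := by
    rintro f g ⟨M, hf⟩ ⟨N, hg⟩
    refine ⟨M + N, (BoundedAtFilter.mul hf hg).congr_left fun z => ?_⟩
    simp only [Pi.mul_apply, pow_add]
    ring
  one_mem' := ⟨0, by simpa using! const_boundedAtFilter _ _⟩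
  add_mem' := by
    rintro f g ⟨M, hf⟩ ⟨N, hg⟩
    refine ⟨M + N, (BoundedAtFilter.add (BoundedAtFilter.mul (boundedAtFilter_qParam_pow N) hf)
      (BoundedAtFilter.mul (boundedAtFilter_qParam_pow M) hg)).congr_left fun z => ?_⟩
    simp only [Pi.mul_apply, Pi.add_apply, pow_add]
    ring
  zero_mem' := ⟨0, by simpa using! const_boundedAtFilter _ _⟩
  neg_mem' := by
    rintro f ⟨M, hf⟩
    exact ⟨M, (BoundedAtFilter.neg hf).congr_left fun z => by simp⟩

/-- The monic polynomial whose roots are the values at `z` of the `ℓ + 1` conjugates of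
`𝔣(ℓτ)`. -/
def conjPoly (ℓ : ℕ) [NeZero ℓ] (z : ℂ) : ℂ[X] :=
  ∏ i : Option (ZMod ℓ), (X - C (weberConj ℓ i z))

lemma conjPoly_monic (ℓ : ℕ) [NeZero ℓ] (z : ℂ) : (conjPoly ℓ z).Monic :=
  monic_prod_X_sub_C _ _

lemma card_option_zmod (ℓ : ℕ) [NeZero ℓ] : Fintype.card (Option (ZMod ℓ)) = ℓ + 1 := by
  rw [Fintype.card_option, ZMod.card]

lemma natDegree_conjPoly (ℓ : ℕ) [NeZero ℓ] (z : ℂ) : (conjPoly ℓ z).natDegree = ℓ + 1 := by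
  rw [conjPoly, natDegree_finsetProd_X_sub_C_eq_card, Finset.card_univ, card_option_zmod]

lemma conjPoly_neg_inv {ℓ : ℕ} [Fact ℓ.Prime] (h48 : ℓ.Coprime 48) {z : ℂ} (hz : 0 < z.im) :
    conjPoly ℓ (-1 / z) = conjPoly ℓ z := by
  simp only [conjPoly, weberConj_neg_inv h48 _ hz]
  exact Equiv.prod_comp (negInvPerm_involutive h48).toPerm fun i => X - C (weberConj ℓ i z)

lemma coeff_conjPoly_add_two {ℓ : ℕ} [NeZero ℓ] (h48 : ℓ.Coprime 48) (n : ℕ) (z : ℂ) :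
    (conjPoly ℓ (z + 2)).coeff n =
      ((zeta24 ^ ℓ)⁻¹ ^ (ℓ + 1) * (zeta24 ^ ℓ) ^ n) * (conjPoly ℓ z).coeff n := by
  have hperm : conjPoly ℓ z = ∏ i, (X - C (weberConj ℓ (addTwoPerm ℓ i) z)) :=
    (Equiv.prod_comp (addTwoPerm ℓ) fun i => X - C (weberConj ℓ i z)).symm
  have hζ : (zeta24 ^ ℓ) ^ n ≠ 0 := pow_ne_zero _ (pow_ne_zero _ zeta24_ne_zero)
  rw [hperm]
  simp only [conjPoly, weberConj_add_two h48]
  rw [mul_right_comm, ← card_option_zmod ℓ, ← Finset.card_univ,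
    ← coeff_prod_X_sub_C_mul_pow, inv_pow, inv_mul_cancel_right₀ hζ]

lemma coeff_conjPoly_mem {ℓ : ℕ} [NeZero ℓ] {A : Subring (ℂ → ℂ)} (hA : ∀ i, weberConj ℓ i ∈ A)
    (n : ℕ) : (fun z => (conjPoly ℓ z).coeff n) ∈ A := by
  convert coeff_prod_X_sub_C_mem (s := Finset.univ) (fun i _ => hA i) n using 1
  ext z
  have hmap : (∏ i, (X - C (weberConj ℓ i))).map (Pi.evalRingHom (fun _ => ℂ) z) =
      conjPoly ℓ z := by
    simp [conjPoly, Polynomial.map_prod]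
  rw [← hmap, coeff_map, Pi.evalRingHom_apply]

lemma isThetaFunction_coeff_conjPoly {ℓ : ℕ} [Fact ℓ.Prime] (h48 : ℓ.Coprime 48) (n : ℕ) :
    IsThetaFunction ((zeta24 ^ ℓ)⁻¹ ^ (ℓ + 1) * (zeta24 ^ ℓ) ^ n)
      fun z => (conjPoly ℓ z).coeff n where
  differentiableAt hz := coeff_conjPoly_mem (A := holomorphicSubring)
    (fun i _ hz => differentiableAt_weberConj i hz) n _ hz
  add_two := coeff_conjPoly_add_two h48 n
  neg_inv hz := by rw [conjPoly_neg_inv h48 hz]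
  boundedAtCuspOne := coeff_conjPoly_mem (A := boundedAtCuspOneSubring)
    (fun i => (tendsto_weberConj_one_sub_inv
      (Nat.coprime_two_right.mp (h48.coprime_dvd_right (by norm_num))) i).isBigO_one ℝ) n

lemma exists_polynomial_coeff_conjPoly {ℓ : ℕ} [Fact ℓ.Prime] (h48 : ℓ.Coprime 48) (n : ℕ) :
    ∃ p : ℂ[X], ∀ z : ℂ, 0 < z.im → (conjPoly ℓ z).coeff n = p.eval (weberF z) := by
  obtain ⟨N, hN⟩ := coeff_conjPoly_mem (ℓ := ℓ) (A := moderateGrowthSubring) (fun i => ⟨ℓ, by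
    rcases i with _ | k
    · exact tendsto_weberConj_none.isBigO_one ℝ
    · exact (tendsto_weberConj_some_zero (Fact.out : ℓ.Prime).one_lt k).isBigO_one ℝ⟩) n
  refine (isThetaFunction_coeff_conjPoly h48 n).exists_polynomial ?_ hN
  rw [mul_pow, pow_right_comm _ _ 24, pow_right_comm _ n 24, inv_pow, pow_right_comm _ ℓ 24,
    zeta24_pow, one_pow, inv_one, one_pow, one_pow, one_mul]

lemma exists_bivariate_conjPoly {ℓ : ℕ} [Fact ℓ.Prime] (h48 : ℓ.Coprime 48) :
    ∃ F : ℂ[X][X], F.Monic ∧ F.natDegree = ℓ + 1 ∧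
      ∀ z : ℂ, 0 < z.im → F.map (evalRingHom (weberF z)) = conjPoly ℓ z := by
  obtain ⟨F, hmonic, hdeg, hF⟩ :=
    exists_monic_map_eq (fun τ : UpperHalfPlane => evalRingHom (weberF τ))
      (fun τ => conjPoly_monic ℓ τ) (fun τ => natDegree_conjPoly ℓ τ) fun n =>
        (exists_polynomial_coeff_conjPoly h48 n).imp fun _ hp τ => hp τ τ.2
  exact ⟨F, hmonic, hdeg, fun z hz => hF ⟨z, hz⟩⟩

/-! ### Relations between `𝔣(τ)` and `𝔣(ℓτ)` -/

/-- The ideal of the bivariate polynomials `Q` with `Q(𝔣(τ), 𝔣(ℓτ)) = 0` on the upper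
half-plane. -/
def weberRelations (ℓ : ℕ) : Ideal ℂ[X][X] :=
  RingHom.ker <| RingHom.pi fun τ : UpperHalfPlane =>
    evalEvalRingHom (weberF τ) (weberF ((ℓ : ℂ) * τ))

lemma mem_weberRelations {ℓ : ℕ} {Q : ℂ[X][X]} :
    Q ∈ weberRelations ℓ ↔
      ∀ z : ℂ, 0 < z.im → Q.evalEval (weberF z) (weberF (ℓ * z)) = 0 := by
  rw [weberRelations, RingHom.mem_ker, funext_iff]
  exact ⟨fun h z hz => h ⟨z, hz⟩, fun h τ => h τ τ.2⟩

lemma differentiableAt_evalEval_weberF {ℓ : ℕ} [NeZero ℓ] (Q : ℂ[X][X]) {z : ℂ} (hz : 0 < z.im) :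
    DifferentiableAt ℂ (fun z => Q.evalEval (weberF z) (weberF (ℓ * z))) z := by
  obtain ⟨M, hM, hM'⟩ := exists_natDegree_bound Q
  simp only [evalEval_eq_sum Q hM hM']
  have hf := differentiableAt_weberF hz
  have hfℓ : DifferentiableAt ℂ (fun w : ℂ => weberF (ℓ * w)) z :=
    (differentiableAt_weberF (im_nat_mul_pos (NeZero.pos ℓ) hz)).comp z (f := fun w : ℂ => ℓ * w)
      (by fun_prop)
  fun_prop

instance isPrime_weberRelations (ℓ : ℕ) [NeZero ℓ] : (weberRelations ℓ).IsPrime where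
  ne_top' h := by
    have hone := mem_weberRelations.mp ((Ideal.eq_top_iff_one _).mp h) I (by simp)
    rw [evalEval_one] at hone
    exact one_ne_zero hone
  mem_or_mem' {P Q} hPQ := by
    simp only [mem_weberRelations, evalEval_mul] at hPQ ⊢
    exact eq_zero_or_eq_zero_of_mul_eq_zero (fun z hz => differentiableAt_evalEval_weberF _ hz)
      (fun z hz => differentiableAt_evalEval_weberF _ hz) hPQ

lemma mem_weberRelations_of_map_eq_conjPoly {ℓ : ℕ} [NeZero ℓ] {F : ℂ[X][X]}
    (hF : ∀ z : ℂ, 0 < z.im → F.map (evalRingHom (weberF z)) = conjPoly ℓ z) :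
    F ∈ weberRelations ℓ := by
  refine mem_weberRelations.mpr fun z hz => ?_
  rw [← map_evalRingHom_eval, hF z hz, conjPoly, eval_prod]
  exact Finset.prod_eq_zero (Finset.mem_univ none) (by simp [weberConj])

-- The substitutions `τ ↦ -1/τ` and `τ ↦ τ + 48` fix `𝔣(τ)` and permute the conjugates transitively.
lemma evalEval_weberConj_eq_zero {ℓ : ℕ} [Fact ℓ.Prime] (h48 : ℓ.Coprime 48) {Q : ℂ[X][X]}
    (hQ : Q ∈ weberRelations ℓ) (i : Option (ZMod ℓ)) {z : ℂ} (hz : 0 < z.im) :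
    Q.evalEval (weberF z) (weberConj ℓ i z) = 0 := by
  rw [mem_weberRelations] at hQ
  have hsome (n : ℕ) {z : ℂ} (hz : 0 < z.im) :
      Q.evalEval (weberF z) (weberConj ℓ (some (n : ZMod ℓ)) z) = 0 := by
    induction n generalizing z with
    | zero =>
      have hinv := hQ _ (im_neg_one_div_pos hz)
      rw [weberF_neg_inv hz] at hinv
      rw [Nat.cast_zero]
      exact weberConj_neg_inv h48 none hz ▸ hinv
    | succ n ih =>
      have hshift := ih (z := z + 48) (by simpa using hz)
      have hper : weberF (z + 48) = weberF z := by
        exact_mod_cast weberF_add_int_of_dvd (m := 48) (dvd_refl _) z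
      rw [hper, weberConj_add_fortyeight] at hshift
      simpa using hshift
  rcases i with _ | k
  · exact hQ z hz
  · simpa using hsome k.val hz

lemma tendsto_weberF_cobounded : Tendsto weberF I∞ (Bornology.cobounded ℂ) := by
  rw [← tendsto_norm_atTop_iff_cobounded]
  have hq : Tendsto (fun z => ‖(qParam 48 z)⁻¹‖) I∞ atTop :=
    tendsto_norm_atTop_iff_cobounded.mpr
      (tendsto_inv₀_nhdsNE_zero.comp (qParam_tendsto (h := 48) (by norm_num)))
  refine (hq.atTop_mul_pos (by simp) tendsto_qParam_mul_weberF.norm).congr fun z => ?_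
  rw [← norm_mul, inv_mul_cancel_left₀ (qParam_ne_zero z)]

lemma eventually_eval_weberF_ne_zero {p : ℂ[X]} (hp : p ≠ 0) :
    ∀ᶠ z in I∞, p.eval (weberF z) ≠ 0 :=
  tendsto_weberF_cobounded.eventually (finite_setOfPred_isRoot hp).isBounded

-- For `τ` high in the upper half-plane, the `ℓ + 1` conjugates are distinct roots of `Q(𝔣(τ), y)`.
lemma eq_zero_of_mem_weberRelations {ℓ : ℕ} [Fact ℓ.Prime] (h48 : ℓ.Coprime 48) {Q : ℂ[X][X]}
    (hQ : Q ∈ weberRelations ℓ) (hdeg : Q.natDegree ≤ ℓ) : Q = 0 := by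
  by_contra hne
  obtain ⟨z, hlead, hinj, hz⟩ :=
    ((eventually_eval_weberF_ne_zero (leadingCoeff_ne_zero.mpr hne)).and
      ((eventually_injective_weberConj (Fact.out : ℓ.Prime).one_lt).and eventually_im_pos)).exists
  have hmap : Q.map (evalRingHom (weberF z)) = 0 := by
    refine eq_zero_of_natDegree_lt_card_of_eval_eq_zero _ hinj (fun i => ?_) ?_
    · rw [map_evalRingHom_eval]
      exact evalEval_weberConj_eq_zero h48 hQ i hz
    · rw [card_option_zmod]
      exact (natDegree_map_le.trans hdeg).trans_lt ℓ.lt_succ_self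
  apply hlead
  rw [← coe_evalRingHom, leadingCoeff, ← coeff_map, hmap, coeff_zero]

lemma eq_C_coeff_mul_of_mem_weberRelations {ℓ : ℕ} [Fact ℓ.Prime] (h48 : ℓ.Coprime 48)
    {F Q : ℂ[X][X]} (hF : F ∈ weberRelations ℓ) (hmonic : F.Monic) (hFdeg : F.natDegree = ℓ + 1)
    (hQ : Q ∈ weberRelations ℓ) (hQdeg : Q.natDegree ≤ ℓ + 1) :
    Q = C (Q.coeff (ℓ + 1)) * F := by
  rw [← sub_eq_zero]
  refine eq_zero_of_mem_weberRelations h48 (sub_mem hQ (Ideal.mul_mem_left _ _ hF)) ?_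
  refine natDegree_le_iff_coeff_eq_zero.mpr fun j hj => ?_
  rw [coeff_sub, coeff_C_mul]
  obtain rfl | hj : j = ℓ + 1 ∨ ℓ + 1 < j := by omega
  · rw [← hFdeg, hmonic.coeff_natDegree, mul_one, sub_self]
  · rw [coeff_eq_zero_of_natDegree_lt (hQdeg.trans_lt hj),
      coeff_eq_zero_of_natDegree_lt (hFdeg.trans_lt hj), mul_zero, sub_zero]

/-! ### Rationality -/

lemma contDiffAt_zero_of_differentiableOn_ball {F : ℂ → ℂ}
    (hF : DifferentiableOn ℂ F (Metric.ball 0 1)) {n : ℕ} : ContDiffAt ℂ n F 0 :=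
  (hF.analyticAt (Metric.ball_mem_nhds 0 one_pos)).contDiffAt

/-- The subring of functions holomorphic on the unit disc, all of whose derivatives at `0` are
integers. -/
def integralSubring : Subring (ℂ → ℂ) where
  carrier := {F | DifferentiableOn ℂ F (Metric.ball 0 1) ∧
    ∀ n, ∃ m : ℤ, iteratedDeriv n F 0 = m}
  mul_mem' := by
    rintro F G ⟨hF, hF'⟩ ⟨hG, hG'⟩
    refine ⟨hF.mul hG, fun n => ?_⟩
    choose a ha using hF'
    choose b hb using hG'
    rw [iteratedDeriv_mul (contDiffAt_zero_of_differentiableOn_ball hF)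
      (contDiffAt_zero_of_differentiableOn_ball hG)]
    exact ⟨∑ i ∈ Finset.range (n + 1), n.choose i * a i * b (n - i), by simp [ha, hb]⟩
  one_mem' := by
    refine ⟨differentiableOn_const _, fun n => ⟨if n = 0 then 1 else 0, ?_⟩⟩
    rw [Pi.one_def, iteratedDeriv_const]
    split_ifs <;> simp
  add_mem' := by
    rintro F G ⟨hF, hF'⟩ ⟨hG, hG'⟩
    refine ⟨hF.add hG, fun n => ?_⟩
    obtain ⟨a, ha⟩ := hF' n
    obtain ⟨b, hb⟩ := hG' n
    rw [iteratedDeriv_add (contDiffAt_zero_of_differentiableOn_ball hF)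
      (contDiffAt_zero_of_differentiableOn_ball hG)]
    exact ⟨a + b, by simp [ha, hb]⟩
  zero_mem' := by
    refine ⟨differentiableOn_const _, fun n => ⟨0, ?_⟩⟩
    rw [Pi.zero_def, iteratedDeriv_const]
    simp
  neg_mem' := by
    rintro F ⟨hF, hF'⟩
    refine ⟨hF.neg, fun n => ?_⟩
    obtain ⟨a, ha⟩ := hF' n
    exact ⟨-a, by simp [iteratedDeriv_neg, ha]⟩

lemma pow_mem_integralSubring (k : ℕ) : (fun w : ℂ => w ^ k) ∈ integralSubring := by
  suffices hid : (fun w : ℂ => w) ∈ integralSubring from integralSubring.pow_mem hid k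
  refine ⟨differentiableOn_id, fun n => ⟨if n = 1 then 1 else 0, ?_⟩⟩
  rw [iteratedDeriv_fun_id_zero]
  split_ifs <;> simp

lemma tendstoLocallyUniformlyOn_iteratedDeriv {ι : Type*} {l : Filter ι} [l.NeBot]
    {F : ι → ℂ → ℂ} {G : ℂ → ℂ} {U : Set ℂ} (hU : IsOpen U)
    (hF : ∀ i, DifferentiableOn ℂ (F i) U) (hG : TendstoLocallyUniformlyOn F G l U) (n : ℕ) :
    TendstoLocallyUniformlyOn (fun i => iteratedDeriv n (F i)) (iteratedDeriv n G) l U := by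
  induction n generalizing F G with
  | zero => simpa using hG
  | succ n ih =>
    simp only [iteratedDeriv_succ']
    exact ih (fun i => (hF i).deriv hU) (hG.deriv (.of_forall hF) hU)

lemma mem_integralSubring_of_tendsto {ι : Type*} {l : Filter ι} [l.NeBot] {F : ι → ℂ → ℂ}
    {G : ℂ → ℂ} (hF : ∀ i, F i ∈ integralSubring)
    (hG : TendstoLocallyUniformlyOn F G l (Metric.ball 0 1)) : G ∈ integralSubring := by
  refine ⟨hG.differentiableOn (.of_forall fun i => (hF i).1) Metric.isOpen_ball, fun n => ?_⟩
  have hlim := (tendstoLocallyUniformlyOn_iteratedDeriv Metric.isOpen_ball (fun i => (hF i).1)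
    hG n).tendsto_at (Metric.mem_ball_self one_pos)
  obtain ⟨m, hm⟩ := Complex.isClosedEmbedding_intCast.isClosed_range.mem_of_tendsto hlim
    (.of_forall fun i => ((hF i).2 n).imp fun _ => Eq.symm)
  exact ⟨m, hm.symm⟩

lemma eulerProd_comp_mem_integralSubring {g : ℂ → ℂ} (hg : g ∈ integralSubring)
    (hmaps : Set.MapsTo g (Metric.ball 0 1) (Metric.ball 0 1)) :
    (fun w => eulerProd (g w)) ∈ integralSubring := by
  have hprod := ModularForm.multipliableLocallyUniformlyOn_one_sub_pow.hasProdLocallyUniformlyOn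
  refine mem_integralSubring_of_tendsto (fun s => ?_) (TendstoLocallyUniformlyOn.comp hprod g
    hmaps hg.1.continuousOn)
  have hpartial : ∏ i ∈ s, (1 - g ^ (i + 1)) ∈ integralSubring :=
    integralSubring.prod_mem fun i _ =>
      integralSubring.sub_mem integralSubring.one_mem (integralSubring.pow_mem hg _)
  convert hpartial using 1
  ext w
  simp

lemma iteratedDeriv_sum_const_mul {ι : Type*} (s : Finset ι) (c : ι → ℂ) {H : ι → ℂ → ℂ}
    (hH : ∀ i, H i ∈ integralSubring) (n : ℕ) :
    iteratedDeriv n (fun w => ∑ i ∈ s, c i * H i w) 0 =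
      ∑ i ∈ s, c i * iteratedDeriv n (H i) 0 := by
  rw [iteratedDeriv_fun_sum fun i _ =>
    contDiffAt_const.mul (contDiffAt_zero_of_differentiableOn_ball (hH i).1)]
  exact Finset.sum_congr rfl fun i _ => iteratedDeriv_const_mul_field ..

lemma sum_map_mul_eq_zero {ι : Type*} (s : Finset ι) (c : ι → ℂ) {H : ι → ℂ → ℂ}
    (hH : ∀ i, H i ∈ integralSubring) (ψ : ℂ →+ ℂ)
    (hsum : (fun w => ∑ i ∈ s, c i * H i w) =ᶠ[𝓝[≠] 0] fun _ => 0) {w : ℂ} (hw : ‖w‖ < 1) :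
    ∑ i ∈ s, ψ (c i) * H i w = 0 := by
  have hball := Metric.ball_mem_nhds (0 : ℂ) one_pos
  have hdiff (c : ι → ℂ) : DifferentiableOn ℂ (fun w => ∑ i ∈ s, c i * H i w) (Metric.ball 0 1) :=
    DifferentiableOn.fun_sum fun i _ => (hH i).1.const_mul _
  rw [((hdiff c).continuousOn.continuousAt hball).eventuallyEq_nhds_iff_eventuallyEq_nhdsNE
    continuousAt_const] at hsum
  have hderiv (n : ℕ) : iteratedDeriv n (fun w => ∑ i ∈ s, ψ (c i) * H i w) 0 = 0 := by
    choose m hm using fun i => (hH i).2 n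
    have hn : ∑ i ∈ s, c i * m i = 0 := by
      simpa only [iteratedDeriv_sum_const_mul s c hH, hm, iteratedDeriv_const, ite_self]
        using hsum.iteratedDeriv_eq n
    have hmap (i : ι) : ψ (c i) * m i = ψ (c i * m i) := by
      rw [← zsmul_eq_mul', ← zsmul_eq_mul', map_zsmul]
    simp only [iteratedDeriv_sum_const_mul s (fun i => ψ (c i)) hH, hm, hmap]
    rw [← map_sum, hn, map_zero]
  have htaylor := Complex.hasSum_taylorSeries_on_ball (hdiff fun i => ψ (c i)) (z := w)
    (by simpa using hw)
  simp only [hderiv, smul_zero] at htaylor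
  exact htaylor.unique hasSum_zero

/-- The numerator of `𝔣` as a function of `w = exp(2πiτ/48)`. -/
def weberNum (w : ℂ) : ℂ := eulerProd (-w ^ 24)

/-- The denominator of `𝔣` as a function of `w = exp(2πiτ/48)`. -/
def weberDen (w : ℂ) : ℂ := w * eulerProd (w ^ 48)

lemma weberF_eq_div (z : ℂ) : weberF z = weberNum (qParam 48 z) / weberDen (qParam 48 z) := by
  rw [weberF_eq, weberNum, weberDen, inv_mul_eq_div, div_div, mul_comm (eulerProd _)]

lemma weberDen_qParam_ne_zero {z : ℂ} (hz : 0 < z.im) : weberDen (qParam 48 z) ≠ 0 := by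
  refine mul_ne_zero (qParam_ne_zero z) ?_
  rw [qParam_pow_eq_of_div_eq (w := z) (k := 1) (by push_cast; ring)]
  exact ModularForm.eta_tprod_ne_zero hz

lemma mapsTo_pow_ball {k : ℕ} (hk : k ≠ 0) :
    Set.MapsTo (fun w : ℂ => w ^ k) (Metric.ball 0 1) (Metric.ball 0 1) := fun w hw => by
  simpa using pow_lt_one₀ (norm_nonneg w) (by simpa using hw) hk

lemma weberNum_pow_mem_integralSubring {k : ℕ} (hk : k ≠ 0) :
    (fun w => weberNum (w ^ k)) ∈ integralSubring := by
  simp only [weberNum, ← pow_mul]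
  exact eulerProd_comp_mem_integralSubring (integralSubring.neg_mem (pow_mem_integralSubring _))
    fun w hw => by simpa using mapsTo_pow_ball (k := k * 24) (by positivity) hw

lemma weberDen_pow_mem_integralSubring {k : ℕ} (hk : k ≠ 0) :
    (fun w => weberDen (w ^ k)) ∈ integralSubring := by
  simp only [weberDen, ← pow_mul]
  exact integralSubring.mul_mem (pow_mem_integralSubring k)
    (eulerProd_comp_mem_integralSubring (pow_mem_integralSubring _)
      (mapsTo_pow_ball (by positivity)))

/-- The monomial `𝔣(τ) ^ i * 𝔣(ℓτ) ^ j`, multiplied by the `M`-th powers of the denominators of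
`𝔣(τ)` and `𝔣(ℓτ)`, as a function of `w = exp(2πiτ/48)`. Only `i, j ≤ M` is meaningful. -/
def clearedMonomial (ℓ M : ℕ) (p : ℕ × ℕ) (w : ℂ) : ℂ :=
  weberNum w ^ p.1 * weberDen w ^ (M - p.1) *
    (weberNum (w ^ ℓ) ^ p.2 * weberDen (w ^ ℓ) ^ (M - p.2))

lemma clearedMonomial_mem_integralSubring {ℓ : ℕ} (hℓ : ℓ ≠ 0) (M : ℕ) (p : ℕ × ℕ) :
    clearedMonomial ℓ M p ∈ integralSubring := by
  have hnum := weberNum_pow_mem_integralSubring one_ne_zero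
  have hden := weberDen_pow_mem_integralSubring one_ne_zero
  simp only [pow_one] at hnum hden
  exact integralSubring.mul_mem
    (integralSubring.mul_mem (integralSubring.pow_mem hnum _) (integralSubring.pow_mem hden _))
    (integralSubring.mul_mem (integralSubring.pow_mem (weberNum_pow_mem_integralSubring hℓ) _)
      (integralSubring.pow_mem (weberDen_pow_mem_integralSubring hℓ) _))

lemma div_pow_mul_pow_of_le {K : Type*} [Field K] {a b : K} (hb : b ≠ 0) {i M : ℕ} (hi : i ≤ M) :
    (a / b) ^ i * b ^ M = a ^ i * b ^ (M - i) := by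
  rw [div_pow, div_mul_eq_mul_div, mul_div_assoc, pow_sub₀ _ hb hi, div_eq_mul_inv]

lemma sum_weberF_mul_den_pow {ℓ : ℕ} [NeZero ℓ] (M : ℕ) (c : ℕ × ℕ → ℂ) {z : ℂ} (hz : 0 < z.im) :
    (∑ p ∈ Finset.range M ×ˢ Finset.range M, c p * (weberF z ^ p.1 * weberF (ℓ * z) ^ p.2)) *
        (weberDen (qParam 48 z) ^ M * weberDen (qParam 48 (ℓ * z)) ^ M) =
      ∑ p ∈ Finset.range M ×ˢ Finset.range M, c p * clearedMonomial ℓ M p (qParam 48 z) := by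
  rw [Finset.sum_mul]
  refine Finset.sum_congr rfl fun p hp => ?_
  obtain ⟨hi, hj⟩ : p.1 < M ∧ p.2 < M := by simpa using hp
  rw [clearedMonomial, qParam_pow_eq_of_div_eq (w := ℓ * z) rfl, weberF_eq_div, weberF_eq_div,
    ← div_pow_mul_pow_of_le (weberDen_qParam_ne_zero hz) hi.le,
    ← div_pow_mul_pow_of_le (weberDen_qParam_ne_zero (im_nat_mul_pos (NeZero.pos ℓ) hz)) hj.le]
  ring

-- As the `q`-expansions of `𝔣(τ)` and `𝔣(ℓτ)` are integral, a relation between these functions is a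
-- system of linear equations with integral coefficients for the coefficients of the relation.
lemma sum_map_mul_weberF_eq_zero {ℓ : ℕ} [NeZero ℓ] (M : ℕ) (c : ℕ × ℕ → ℂ) (ψ : ℂ →+ ℂ)
    (h : ∀ z : ℂ, 0 < z.im → ∑ p ∈ Finset.range M ×ˢ Finset.range M,
      c p * (weberF z ^ p.1 * weberF (ℓ * z) ^ p.2) = 0) {z : ℂ} (hz : 0 < z.im) :
    ∑ p ∈ Finset.range M ×ˢ Finset.range M,
      ψ (c p) * (weberF z ^ p.1 * weberF (ℓ * z) ^ p.2) = 0 := by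
  have hcleared := sum_map_mul_eq_zero (Finset.range M ×ˢ Finset.range M) c
    (clearedMonomial_mem_integralSubring (NeZero.ne ℓ) M) ψ ?_
    (norm_qParam_lt_one (by norm_num : (0 : ℝ) < 48) hz)
  · rw [← sum_weberF_mul_den_pow M (fun p => ψ (c p)) hz] at hcleared
    exact (mul_eq_zero.mp hcleared).resolve_right <|
      mul_ne_zero (pow_ne_zero _ (weberDen_qParam_ne_zero hz))
        (pow_ne_zero _ (weberDen_qParam_ne_zero (im_nat_mul_pos (NeZero.pos ℓ) hz)))
  · filter_upwards [self_mem_nhdsWithin,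
      nhdsWithin_le_nhds (Metric.ball_mem_nhds (0 : ℂ) one_pos)] with w hw0 hw1
    have him := im_invQParam_pos_of_norm_lt_one (h := 48) (by norm_num) (by simpa using hw1) hw0
    have hw := sum_weberF_mul_den_pow (ℓ := ℓ) M c him
    rw [h _ him, zero_mul, qParam_right_inv (by norm_num) hw0] at hw
    exact hw.symm

lemma mem_weberRelations_of_coeff_eq {ℓ : ℕ} [NeZero ℓ] {F S : ℂ[X][X]}
    (hF : F ∈ weberRelations ℓ) (ψ : ℂ →+ ℂ)
    (hS : ∀ i j, (S.coeff j).coeff i = ψ ((F.coeff j).coeff i)) : S ∈ weberRelations ℓ := by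
  obtain ⟨M, hM, hM'⟩ := exists_natDegree_bound F
  obtain ⟨N, hN, hN'⟩ := exists_natDegree_bound S
  rw [mem_weberRelations] at hF ⊢
  intro z hz
  have hMN : M ≤ max M N := le_max_left _ _
  have hNM : N ≤ max M N := le_max_right _ _
  rw [evalEval_eq_sum S (hN.trans_le hNM) fun j => (hN' j).trans_le hNM]
  simp only [hS]
  refine sum_map_mul_weberF_eq_zero (max M N) (fun p => (F.coeff p.2).coeff p.1) ψ
    (fun z hz => ?_) hz
  rw [← evalEval_eq_sum F (hM.trans_le hMN) fun j => (hM' j).trans_le hMN]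
  exact hF z hz

lemma exists_rational_of_mem_weberRelations {ℓ : ℕ} [Fact ℓ.Prime] (h48 : ℓ.Coprime 48)
    {F : ℂ[X][X]} (hF : F ∈ weberRelations ℓ) (hmonic : F.Monic) (hdeg : F.natDegree = ℓ + 1) :
    ∃ R : ℚ[X][X], bivariateMap (algebraMap ℚ ℂ) R = F := by
  obtain ⟨φ, hφ⟩ := LinearMap.exists_leftInverse_of_injective (Algebra.linearMap ℚ ℂ)
    (LinearMap.ker_eq_bot.mpr (algebraMap ℚ ℂ).injective)
  have hφ1 : φ 1 = 1 := by simpa using DFunLike.congr_fun hφ 1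
  obtain ⟨R, hR⟩ := exists_coeff_coeff_eq_apply_coeff_coeff (map_zero φ) F
  set S := bivariateMap (algebraMap ℚ ℂ) R with hS
  have hcoeff (i j : ℕ) : (S.coeff j).coeff i = (φ ((F.coeff j).coeff i) : ℂ) := by
    simp [hS, bivariateMap, hR]
  have hSmem : S ∈ weberRelations ℓ := mem_weberRelations_of_coeff_eq hF
    ((algebraMap ℚ ℂ).toAddMonoidHom.comp φ.toAddMonoidHom) hcoeff
  have hSdeg : S.natDegree ≤ ℓ + 1 := natDegree_le_iff_coeff_eq_zero.mpr fun j hj => by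
    ext i
    rw [hcoeff, coeff_eq_zero_of_natDegree_lt (hdeg.trans_lt hj), coeff_zero, map_zero,
      Rat.cast_zero]
  have hSlead : S.coeff (ℓ + 1) = 1 := by
    ext i
    rw [hcoeff, ← hdeg, hmonic.coeff_natDegree, coeff_one]
    split_ifs <;> simp [hφ1]
  have hSF := eq_C_coeff_mul_of_mem_weberRelations h48 hF hmonic hdeg hSmem hSdeg
  exact ⟨R, by rw [← hS, hSF, hSlead, C_1, one_mul]⟩

lemma exists_monic_relation {ℓ : ℕ} [Fact ℓ.Prime] (h48 : ℓ.Coprime 48) :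
    ∃ R : ℚ[X][X], bivariateMap (algebraMap ℚ ℂ) R ∈ weberRelations ℓ ∧ R.Monic ∧
      R.natDegree = ℓ + 1 := by
  obtain ⟨F, hmonic, hdeg, hF⟩ := exists_bivariate_conjPoly h48
  have hmem := mem_weberRelations_of_map_eq_conjPoly hF
  obtain ⟨R, rfl⟩ := exists_rational_of_mem_weberRelations h48 hmem hmonic hdeg
  exact ⟨R, hmem, monic_of_injective (map_injective _ (algebraMap ℚ ℂ).injective) hmonic,
    (natDegree_bivariateMap (algebraMap ℚ ℂ).injective R).symm.trans hdeg⟩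

/-! ### Integral relations -/

lemma bivariateMap_algebraMap_bivariateMap_intCast (P : ℤ[X][X]) :
    bivariateMap (algebraMap ℚ ℂ) (bivariateMap (Int.castRingHom ℚ) P) =
      bivariateMap (Int.castRingHom ℂ) P := by
  simp only [bivariateMap, coe_mapRingHom, Polynomial.map_map, mapRingHom_comp]
  congr 2

lemma dvd_of_mem_weberRelations {ℓ : ℕ} [Fact ℓ.Prime] (h48 : ℓ.Coprime 48) {R P : ℚ[X][X]}
    (hR : bivariateMap (algebraMap ℚ ℂ) R ∈ weberRelations ℓ) (hmonic : R.Monic)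
    (hdeg : R.natDegree = ℓ + 1) (hP : bivariateMap (algebraMap ℚ ℂ) P ∈ weberRelations ℓ) :
    R ∣ P := by
  have hinj := (algebraMap ℚ ℂ).injective
  rw [← modByMonic_eq_zero_iff_dvd hmonic, ← map_eq_zero_iff _ (bivariateMap_injective hinj)]
  refine eq_zero_of_mem_weberRelations h48 ?_ ?_
  · rw [modByMonic_eq_sub_mul_div, map_sub, map_mul]
    exact sub_mem hP (Ideal.mul_mem_right _ _ hR)
  · have hlt := natDegree_modByMonic_lt P hmonic (by rintro rfl; simp at hdeg)
    rw [natDegree_bivariateMap hinj]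
    lia

lemma prime_bivariateMap_of_irreducible {ℓ : ℕ} [Fact ℓ.Prime] (h48 : ℓ.Coprime 48) {P : ℤ[X][X]}
    (hirr : Irreducible P) (hP : bivariateMap (Int.castRingHom ℂ) P ∈ weberRelations ℓ) :
    Prime (bivariateMap (Int.castRingHom ℚ) P) := by
  have hinj : Function.Injective (Int.castRingHom ℂ) := RingHom.injective_int _
  have hdeg : ℓ < P.natDegree := by
    by_contra! hle
    rw [← natDegree_bivariateMap hinj] at hle
    exact hirr.ne_zero <| (map_eq_zero_iff _ (bivariateMap_injective hinj)).mp <|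
      eq_zero_of_mem_weberRelations h48 hP hle
  let _ : Algebra ℤ[X][X] ℚ[X][X] := (bivariateMap (Int.castRingHom ℚ)).toAlgebra
  have := isLocalization_nonzeroIntegers
  refine prime_algebraMap_of_isLocalization nonzeroIntegers nonzeroIntegers_le_nonZeroDivisors
    hirr.prime fun Q hQ hPQ => ?_
  obtain ⟨n, hn, rfl⟩ := mem_nonzeroIntegers.mp hQ
  have hle := natDegree_le_of_dvd hPQ (by simpa using hn)
  rw [natDegree_C] at hle
  lia

lemma exists_eq_C_mul_of_irreducible {ℓ : ℕ} [Fact ℓ.Prime] (h48 : ℓ.Coprime 48) {R : ℚ[X][X]}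
    (hR : bivariateMap (algebraMap ℚ ℂ) R ∈ weberRelations ℓ) (hmonic : R.Monic)
    (hdeg : R.natDegree = ℓ + 1) {P : ℤ[X][X]} (hirr : Irreducible P)
    (hP : bivariateMap (Int.castRingHom ℂ) P ∈ weberRelations ℓ) :
    ∃ g : ℚ, bivariateMap (Int.castRingHom ℚ) P = C (C g) * R := by
  have hprime := prime_bivariateMap_of_irreducible h48 hirr hP
  rw [← bivariateMap_algebraMap_bivariateMap_intCast] at hP
  obtain ⟨G, hG⟩ := dvd_of_mem_weberRelations h48 hR hmonic hdeg hP
  have hRunit : ¬ IsUnit R := hmonic.isUnit_iff.not.mpr (by rintro rfl; simp at hdeg)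
  have hGunit : IsUnit G := (hprime.irreducible.isUnit_or_isUnit hG).resolve_left hRunit
  obtain ⟨p, hp, rfl⟩ := isUnit_iff.mp hGunit
  obtain ⟨g, -, rfl⟩ := isUnit_iff.mp hp
  exact ⟨g, by rw [hG, mul_comm]⟩

lemma exists_irreducible_relation {ℓ : ℕ} [Fact ℓ.Prime] (h48 : ℓ.Coprime 48) :
    ∃ P : ℤ[X][X], Irreducible P ∧ bivariateMap (Int.castRingHom ℂ) P ∈ weberRelations ℓ := by
  obtain ⟨R, hR, hmonic, -⟩ := exists_monic_relation h48
  let _ : Algebra ℤ[X][X] ℚ[X][X] := (bivariateMap (Int.castRingHom ℚ)).toAlgebra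
  have := isLocalization_nonzeroIntegers
  obtain ⟨⟨P, N⟩, hPN⟩ := IsLocalization.surj nonzeroIntegers R
  change R * bivariateMap (Int.castRingHom ℚ) N = bivariateMap (Int.castRingHom ℚ) P at hPN
  let J := (weberRelations ℓ).comap (bivariateMap (Int.castRingHom ℂ))
  have hPJ : P ∈ J := by
    rw [Ideal.mem_comap, ← bivariateMap_algebraMap_bivariateMap_intCast, ← hPN, map_mul]
    exact Ideal.mul_mem_right _ _ hR
  have hJ : J ≠ ⊥ := by
    intro hbot
    have hP0 : P = 0 := by simpa [hbot] using hPJ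
    rw [hP0, map_zero, mul_eq_zero, or_iff_right hmonic.ne_zero,
      map_eq_zero_iff _ (bivariateMap_injective (RingHom.injective_int _))] at hPN
    exact nonZeroDivisors.ne_zero (nonzeroIntegers_le_nonZeroDivisors N.2) hPN
  have hJprime : J.IsPrime := Ideal.comap_isPrime ..
  obtain ⟨Φ, hΦ, hprime⟩ := hJprime.exists_mem_prime_of_ne_bot hJ
  exact ⟨Φ, hprime.irreducible, hΦ⟩

/-! ### The symmetry -/

lemma scaleHom_mem_weberRelations {ℓ : ℕ} {ζ : ℂ} (hζ : IsPrimitiveRoot ζ 24) {Q : ℂ[X][X]}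
    (hQ : Q ∈ weberRelations ℓ) : scaleHom ζ (ζ ^ ℓ) Q ∈ weberRelations ℓ := by
  rw [mem_weberRelations] at hQ ⊢
  intro z hz
  obtain ⟨k, -, rfl⟩ := zeta24_isPrimitiveRoot.eq_pow_of_pow_eq_one hζ.pow_eq_one
  have hx := weberF_add_two_mul_int (-k) z
  have hy := weberF_add_two_mul_int (-(k * ℓ)) (ℓ * z)
  have hshift := hQ (z + 2 * ((-k : ℤ) : ℂ)) (by simpa using hz)
  have hmul : (ℓ : ℂ) * (z + 2 * ((-k : ℤ) : ℂ)) = ℓ * z + 2 * ((-(k * ℓ) : ℤ) : ℂ) := by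
    push_cast
    ring
  rw [hmul, hx, hy, neg_neg, neg_neg] at hshift
  rw [evalEval_scaleHom, ← pow_mul]
  exact_mod_cast hshift

lemma pow_mul_add_one_eq {M : Type*} [Monoid M] {ζ : M} (hζ : ζ ^ 24 = 1) {ℓ : ℕ}
    (h48 : ℓ.Coprime 48) : ζ ^ (ℓ * (ℓ + 1)) = ζ ^ (ℓ + 1) := by
  have hmod : ℓ * (ℓ + 1) ≡ ℓ + 1 [MOD 24] := by
    rw [← Int.natCast_modEq_iff, Int.modEq_comm, Int.modEq_iff_dvd]
    push_cast
    convert twentyFour_dvd_sq_sub_one h48 using 1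
    ring
  exact pow_eq_pow_of_modEq hmod hζ

-- Both sides are relations of degree `ℓ + 1`, so only their leading coefficients need comparing.
lemma scaleHom_eq {ℓ : ℕ} [Fact ℓ.Prime] (h48 : ℓ.Coprime 48) {F : ℂ[X][X]}
    (hF : F ∈ weberRelations ℓ) (hmonic : F.Monic) (hdeg : F.natDegree = ℓ + 1)
    {ζ : ℂ} (hζ : IsPrimitiveRoot ζ 24) :
    scaleHom ζ (ζ ^ ℓ) F = C (C (ζ ^ (ℓ + 1))) * F := by
  have hcoeff : (scaleHom ζ (ζ ^ ℓ) F).coeff (ℓ + 1) = C (ζ ^ (ℓ + 1)) := by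
    rw [coeff_scaleHom, ← hdeg, hmonic.coeff_natDegree, hdeg, one_comp, one_mul, ← C_pow,
      ← pow_mul, pow_mul_add_one_eq hζ.pow_eq_one h48]
  have hle : (scaleHom ζ (ζ ^ ℓ) F).natDegree ≤ ℓ + 1 :=
    natDegree_le_iff_coeff_eq_zero.mpr fun n hn => by
      rw [coeff_scaleHom, coeff_eq_zero_of_natDegree_lt (hdeg.trans_lt hn), zero_comp, zero_mul]
  rw [eq_C_coeff_mul_of_mem_weberRelations h48 hF hmonic hdeg
    (scaleHom_mem_weberRelations hζ hF) hle, hcoeff]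

lemma scaleHom_bivariateMap_eq {ℓ : ℕ} [Fact ℓ.Prime] (h48 : ℓ.Coprime 48) {P : ℤ[X][X]}
    (hirr : Irreducible P) (hP : bivariateMap (Int.castRingHom ℂ) P ∈ weberRelations ℓ)
    {ζ : ℂ} (hζ : IsPrimitiveRoot ζ 24) :
    scaleHom ζ (ζ ^ ℓ) (bivariateMap (Int.castRingHom ℂ) P) =
      C (C (ζ ^ (ℓ + 1))) * bivariateMap (Int.castRingHom ℂ) P := by
  obtain ⟨R, hR, hmonic, hdeg⟩ := exists_monic_relation h48
  obtain ⟨g, hg⟩ := exists_eq_C_mul_of_irreducible h48 hR hmonic hdeg hirr hP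
  have hscale := scaleHom_eq h48 hR (hmonic.map _)
    ((natDegree_bivariateMap (algebraMap ℚ ℂ).injective R).trans hdeg) hζ
  have hC : bivariateMap (algebraMap ℚ ℂ) (C (C g)) = C (C (g : ℂ)) := by simp [bivariateMap]
  rw [← bivariateMap_algebraMap_bivariateMap_intCast, hg, map_mul, map_mul, hscale, hC,
    scaleHom_C_C]
  ring

open Polynomial.Bivariate in
lemma aeval_equivMvPolynomial (P : ℤ[X][X]) (x y : ℂ) :
    MvPolynomial.aeval ![x, y] (equivMvPolynomial ℤ P) =
      (bivariateMap (Int.castRingHom ℂ) P).evalEval x y := by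
  have hcomp : ((MvPolynomial.aeval ![x, y]).toRingHom : MvPolynomial (Fin 2) ℤ →+* ℂ).comp
      (equivMvPolynomial ℤ).toRingEquiv.toRingHom =
      (evalEvalRingHom x y).comp (bivariateMap (Int.castRingHom ℂ)) := by
    ext <;> simp [bivariateMap]
  exact DFunLike.congr_fun hcomp P

open Polynomial.Bivariate in
lemma map_equivMvPolynomial (P : ℤ[X][X]) :
    MvPolynomial.map (Int.castRingHom ℂ) (equivMvPolynomial ℤ P) =
      equivMvPolynomial ℂ (bivariateMap (Int.castRingHom ℂ) P) := by
  have hcomp : (MvPolynomial.map (Int.castRingHom ℂ)).comp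
      (equivMvPolynomial ℤ).toRingEquiv.toRingHom =
      (equivMvPolynomial ℂ).toRingEquiv.toRingHom.comp (bivariateMap (Int.castRingHom ℂ)) := by
    ext <;> simp [bivariateMap]
  exact DFunLike.congr_fun hcomp P

open Polynomial.Bivariate in
lemma aeval_scale_equivMvPolynomial (P : ℤ[X][X]) (a b : ℂ) :
    MvPolynomial.aeval
      ![(MvPolynomial.C a * MvPolynomial.X 0 : MvPolynomial (Fin 2) ℂ),
        MvPolynomial.C b * MvPolynomial.X 1] (equivMvPolynomial ℤ P) =
      equivMvPolynomial ℂ (scaleHom a b (bivariateMap (Int.castRingHom ℂ) P)) := by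
  have hcomp : ((MvPolynomial.aeval ![(MvPolynomial.C a * MvPolynomial.X 0 :
      MvPolynomial (Fin 2) ℂ), MvPolynomial.C b * MvPolynomial.X 1]).toRingHom :
        MvPolynomial (Fin 2) ℤ →+* MvPolynomial (Fin 2) ℂ).comp
      (equivMvPolynomial ℤ).toRingEquiv.toRingHom =
      (equivMvPolynomial ℂ).toRingEquiv.toRingHom.comp
        ((scaleHom a b).comp (bivariateMap (Int.castRingHom ℂ))) := by
    ext <;> simp [bivariateMap, scaleHom]
  exact DFunLike.congr_fun hcomp P

lemma isWeberModularPolynomial_equivMvPolynomial {ℓ : ℕ} {P : ℤ[X][X]} :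
    IsWeberModularPolynomial ℓ (Polynomial.Bivariate.equivMvPolynomial ℤ P) ↔
      Irreducible P ∧ bivariateMap (Int.castRingHom ℂ) P ∈ weberRelations ℓ := by
  refine and_congr (MulEquiv.irreducible_iff (Polynomial.Bivariate.equivMvPolynomial ℤ)) ?_
  simp only [aeval_equivMvPolynomial, mem_weberRelations]
  exact ⟨fun h z hz => h ⟨z, hz⟩, fun h τ => h τ τ.2⟩

end WeberModular

end

theorem mainTheorem4 (ℓ : ℕ) (hℓ : ℓ.Prime) (hℓ48 : Nat.Coprime ℓ 48) :
    (∃ Φ : MvPolynomial (Fin 2) ℤ, WeberModular.IsWeberModularPolynomial ℓ Φ) ∧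
    ∀ Φ : MvPolynomial (Fin 2) ℤ, WeberModular.IsWeberModularPolynomial ℓ Φ →
      ∀ ζ : ℂ, IsPrimitiveRoot ζ 24 →
        MvPolynomial.aeval
            ![MvPolynomial.C ζ * MvPolynomial.X 0, MvPolynomial.C (ζ ^ ℓ) * MvPolynomial.X 1] Φ =
          (MvPolynomial.C (ζ ^ (ℓ + 1)) * MvPolynomial.map (Int.castRingHom ℂ) Φ :
            MvPolynomial (Fin 2) ℂ) := by
  have : Fact ℓ.Prime := ⟨hℓ⟩
  constructor
  · obtain ⟨P, hP⟩ := WeberModular.exists_irreducible_relation hℓ48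
    exact ⟨_, WeberModular.isWeberModularPolynomial_equivMvPolynomial.mpr hP⟩
  · intro Φ hΦ ζ hζ
    obtain ⟨P, rfl⟩ := (Polynomial.Bivariate.equivMvPolynomial ℤ).surjective Φ
    obtain ⟨hirr, hP⟩ := WeberModular.isWeberModularPolynomial_equivMvPolynomial.mp hΦ
    rw [WeberModular.aeval_scale_equivMvPolynomial, WeberModular.map_equivMvPolynomial,
      WeberModular.scaleHom_bivariateMap_eq hℓ48 hirr hP hζ, map_mul,
      Polynomial.Bivariate.equivMvPolynomial_C_C]
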